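/- **Setting.** Let $N\ge 1$, $P_s,P_I,N_0,\eta,d_1,d_I,d_2>0$, $0<\theta<1$, $\tau\in\mathbb R$, and put $\rho_1=P_s/N_0$, $\rho_I=P_I/N_0$. Let $\mathbf h_1,\mathbf h_I\in\mathbb C^{N}$ (columns) and $\mathbf h_2\in\mathbb C^{1\times N}$ (a row) be random vectors all of whose $3N$ entries are i.i.d. $\mathcal{CN}(0,1)$. In the dual-hop amplify-and-forward power-splitting energy harvesting system with one co-channel interferer at the $N$-antenna relay, the MRC/MRT relay uses $\mathbf W=\omega\,\mathbf h_2^\dagger\mathbf h_1^\dagger/(\|\mathbf h_2\|\|\mathbf h_1\|)$ with $$\omega^2=\frac{\eta\theta\big(\frac{P_s}{d_1^\tau}\|\mathbf h_1\|^2+\frac{P_I}{d_I^\tau}\|\mathbf h_I\|^2\big)}{\frac{(1-\theta)P_s}{d_1^\tau}\|\mathbf h_1\|^2+\frac{(1-\theta)P_I}{d_I^\tau}\frac{|\mathbf h_1^\dagger\mathbf h_I|^2}{\|\mathbf h_1\|^2}+N_0},$$ and the end-to-end SINR is $$\gamma_I=\frac{\frac{(1-\theta)P_s}{d_1^\tau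 d_2^\tau}|\mathbf h_2\mathbf W\mathbf h_1|^2}{\frac{(1-\theta)P_I}{d_I^\tau d_2^\tau}|\mathbf h_2\mathbf W\mathbf h_I|^2+\frac{\|\mathbf h_2\mathbf W\|^2}{d_2^\tau}N_0+N_0}=\frac{\gamma_{I1}\gamma_{I2}}{\gamma_{I1}+\gamma_{I2}+1},$$ where $$\gamma_{I1}=\frac{\frac{(1-\theta)\rho_1}{d_1^\tau}\|\mathbf h_1\|^2}{\frac{(1-\theta)\rho_I}{d_I^\tau}\frac{|\mathbf h_1^\dagger\mathbf h_I|^2}{\|\mathbf h_1\|^2}+1},\qquad \gamma_{I2}=\frac{\eta\theta}{d_2^\tau}\Big(\frac{\rho_1}{d_1^\tau}\|\mathbf h_1\|^2+\frac{\rho_I}{d_I^\tau}\|\mathbf h_I\|^2\Big)\|\mathbf h_2\|^2 .$$ The ergodic capacity is $C=\frac12 E[\log_2(1+\gamma_I)]$, and $C_{\gamma_{Ii}}=\frac12E[\log_2(1+\gamma_{Ii})]$, $i=1,2$. **Special functions.** $\psi$ is the digamma function, $\Psi(a,b;z)=\frac1{\Gamma(a)}\int_0^\infty e^{-zt}t^{a-1}(1+t)^{b-a-1}dt$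 is Tricomi's function ($a,z>0$), $G^{m,n}_{p,q}$ is the Meijer G-function, and $$G^{1,1,1,1,1}_{1,[1:1],0,[1:1]}\big(x,y\,\big|\,\varepsilon;\gamma;\gamma';-;\beta;\beta'\big)=\frac1{(2\pi i)^2}\int\!\!\int\Gamma(\varepsilon+s+t)\Gamma(1-\gamma+s)\Gamma(\beta-s)\Gamma(1-\gamma'+t)\Gamma(\beta'-t)x^sy^t\,ds\,dt$$ over vertical lines separating the poles of $\Gamma(\beta-s),\Gamma(\beta'-t)$ from those of the other three factors. **Theorem 6.** If $\rho_1/d_1^\tau\ne\rho_I/d_I^\tau$, then all the expectations $C$, $C_{\gamma_{I1}}$, $C_{\gamma_{I2}}$, $E(\ln\gamma_{I1})$, $E(\ln\gamma_{I2})$ exist (are finite), and $$C\le C_{\gamma_{I1}}+C_{\gamma_{I2}}-\tfrac12\log_2\!\big(1+e^{E(\ln\gamma_{I1})}+e^{E(\ln\gamma_{I2})}\big),$$ where, with $c_s=\prod_{j=1}^{s-1}(1-N-j)$, $$C_{\gamma_{I1}}=\frac{(1-\theta)\rho_1}{2d_1^\tau\ln2}\sum_{m=0}^{N-1}\sum_{n=0}^m\frac{((1-\theta)\rho_I)^n}{d_I^{n\tau}(m-n)!\,n!}\,G^{1,1,1,1,1}_{1,[1:1],0,[1:1]}\Big(\tfrac{(1-\theta)\rho_1}{d_1^\tau},\tfrac{(1-\theta)\rho_I}{d_I^\tau}\,\Big|\,m+1;0;-n;-;0;0\Big),$$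 $$C_{\gamma_{I2}}=\frac{d_1^{N\tau}d_I^{N\tau}}{2\ln2\,\rho_1^N\rho_I^N}\sum_{s=1}^N\frac{c_s}{(N-s)!(s-1)!}\sum_{m=0}^{N-1}\frac1{m!}\Big(\frac{d_2^\tau}{\eta\theta}\Big)^{N+1-s}\Big[\Big(\tfrac{d_I^\tau}{\rho_I}-\tfrac{d_1^\tau}{\rho_1}\Big)^{1-N-s}\mathcal G_{s,m}\Big(\tfrac{d_1^\tau d_2^\tau}{\eta\theta\rho_1}\Big)+\Big(\tfrac{d_1^\tau}{\rho_1}-\tfrac{d_I^\tau}{\rho_I}\Big)^{1-N-s}\mathcal G_{s,m}\Big(\tfrac{d_2^\tau d_I^\tau}{\eta\theta\rho_I}\Big)\Big],$$ $$\mathcal G_{s,m}(z)=G^{3,1}_{1,3}\Big(z\,\Big|\,{s-N-1\atop s-N-1,\;m+s-N-1,\;0}\Big),$$ $$E(\ln\gamma_{I1})=\ln((1-\theta)\rho_1)-\ln d_1^\tau+\psi(1)-e^{\frac{d_I^\tau}{(1-\theta)\rho_I}}G^{3,0}_{2,3}\Big(\tfrac{d_I^\tau}{(1-\theta)\rho_I}\Big|{1,1\atop0,0,1}\Big)+\sum_{m=1}^{N-1}\sum_{n=0}^m\frac{((1-\theta)\rho_I)^{n-m}}{(m-n)!\,d_I^{(n-m)\tau}}\Gamma(m)\Psi\Big(m,m-n;\tfrac{d_I^\tau}{(1-\theta)\rho_I}\Big),$$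 $$E(\ln\gamma_{I2})=\ln(\eta\theta)-\ln d_2^\tau+\psi(N)+\frac{d_I^{N\tau}}{\rho_I^N}\sum_{s=1}^N\frac{c_s}{(s-1)!}\Big(\tfrac{d_I^\tau}{\rho_I}-\tfrac{d_1^\tau}{\rho_1}\Big)^{1-N-s}\Big(\tfrac{\rho_1}{d_1^\tau}\Big)^{1-s}\big(\psi(N-s+1)+\ln\rho_1-\ln d_1^\tau\big)$$ $$\qquad\qquad+\frac{d_1^{N\tau}}{\rho_1^N}\sum_{s=1}^N\frac{c_s}{(s-1)!}\Big(\tfrac{d_1^\tau}{\rho_1}-\tfrac{d_I^\tau}{\rho_I}\Big)^{1-N-s}\Big(\tfrac{\rho_I}{d_I^\tau}\Big)^{1-s}\big(\psi(N-s+1)+\ln\rho_I-\ln d_I^\tau\big).$$ -/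

import Mathlib

open MeasureTheory ProbabilityTheory
open scoped Nat NNReal

noncomputable section

namespace EHRelay

/-! ### Special functions -/

/-- The Mellin-Barnes integrand of the Meijer `G`-function `G_{p,q}^{m,n}(z | a ; b)`. The upper
parameters are split into `an = (a_1, …, a_n)` and `ap = (a_{n+1}, …, a_p)`, the lower ones into
`bm = (b_1, …, b_m)` and `bq = (b_{m+1}, …, b_q)`. -/
def meijerKernel (an ap bm bq : List ℂ) (z s : ℂ) : ℂ :=
  (bm.map fun b => Complex.Gamma (b - s)).prod * (an.map fun a => Complex.Gamma (1 - a + s)).prod /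
    ((bq.map fun b => Complex.Gamma (1 - b + s)).prod *
      (ap.map fun a => Complex.Gamma (a - s)).prod) * z ^ s

/-- The vertical line `Re s = c` has the poles of all `Γ(b_j - s)`, `j ≤ m`, on its right and the
poles of all `Γ(1 - a_j + s)`, `j ≤ n`, on its left. -/
def MeijerSeparates (an bm : List ℂ) (c : ℝ) : Prop :=
  (∀ b ∈ bm, c < b.re) ∧ (∀ a ∈ an, a.re - 1 < c)

open Classical in
/-- The Meijer `G`-function `(1 / 2πi) ∫_L … z^s ds`, where `L` is a vertical line from `c - i∞` to
`c + i∞` that separates the two families of poles (the value does not depend on the choice of the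
line). Parameters for which no such line exists are not needed; the value there is `0`. -/
def meijerG (an ap bm bq : List ℂ) (z : ℂ) : ℂ :=
  if h : ∃ c : ℝ, MeijerSeparates an bm c then
    (1 / (2 * (Real.pi : ℂ))) *
      ∫ y : ℝ, meijerKernel an ap bm bq z ((h.choose : ℂ) + (y : ℂ) * Complex.I)
  else 0

/-- The integrand of the two-variable `G`-function of order `1,1,1,1,1 / 1,[1:1],0,[1:1]`. -/
def bivariateKernel (ε γ γ' β β' x y s t : ℂ) : ℂ :=
  Complex.Gamma (ε + s + t) * (Complex.Gamma (1 - γ + s) * Complex.Gamma (β - s)) *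
    (Complex.Gamma (1 - γ' + t) * Complex.Gamma (β' - t)) * x ^ s * y ^ t

/-- The pair of vertical lines `Re s = c.1`, `Re t = c.2` separates the poles of `Γ(β - s)` and
`Γ(β' - t)` from those of `Γ(1 - γ + s)`, `Γ(1 - γ' + t)` and `Γ(ε + s + t)`. -/
def BivariateSeparates (ε γ γ' β β' : ℂ) (c : ℝ × ℝ) : Prop :=
  c.1 < β.re ∧ γ.re - 1 < c.1 ∧ c.2 < β'.re ∧ γ'.re - 1 < c.2 ∧ -ε.re < c.1 + c.2

open Classical in
/-- The generalized Meijer `G`-function of two variables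
`G_{1,[1:1],0,[1:1]}^{1,1,1,1,1}(x, y | ε; γ; γ' | - ; β; β')`, as the double Mellin-Barnes integral
`(1 / (2πi)²) ∫ ∫ Γ(ε+s+t) Γ(1-γ+s) Γ(β-s) Γ(1-γ'+t) Γ(β'-t) x^s y^t ds dt`
over a separating pair of vertical lines. -/
def bivariateMeijerG (ε γ γ' β β' x y : ℂ) : ℂ :=
  if h : ∃ c : ℝ × ℝ, BivariateSeparates ε γ γ' β β' c then
    (1 / (2 * (Real.pi : ℂ)) ^ 2) *
      ∫ u : ℝ, ∫ v : ℝ, bivariateKernel ε γ γ' β β' x y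
        ((h.choose.1 : ℂ) + (u : ℂ) * Complex.I) ((h.choose.2 : ℂ) + (v : ℂ) * Complex.I)
  else 0

/-- Tricomi's confluent hypergeometric function `Ψ(a, b; z)` for real `a > 0`, `z > 0`. -/
def tricomi (a b z : ℝ) : ℝ :=
  1 / Real.Gamma a *
    ∫ t in Set.Ioi (0 : ℝ), Real.exp (-z * t) * t ^ (a - 1) * (1 + t) ^ (b - a - 1)

/-! ### The relaying system with a single interferer -/

/-- The real parameters of the system. -/
structure Params where
  /-- source power -/
  Ps : ℝ
  /-- interference power -/
  PI : ℝ
  /-- noise power -/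
  N₀ : ℝ
  /-- power splitting ratio -/
  θ : ℝ
  /-- energy conversion efficiency -/
  η : ℝ
  /-- source-relay distance -/
  d₁ : ℝ
  /-- interferer-relay distance -/
  dI : ℝ
  /-- relay-destination distance -/
  d₂ : ℝ
  /-- path loss exponent -/
  τ : ℝ

namespace Params

variable (p : Params)

/-- Source power to noise ratio. -/
def ρ₁ : ℝ := p.Ps / p.N₀

/-- Interference power to noise ratio. -/
def ρI : ℝ := p.PI / p.N₀

variable {N : ℕ} (h₁ hI h₂ : EuclideanSpace ℂ (Fin N))

/-- The transmit power of the relay: energy harvested in the first slot per slot duration. -/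
def relayPower : ℝ :=
  p.η * p.θ * (p.Ps / p.d₁ ^ p.τ * ‖h₁‖ ^ 2 + p.PI / p.dI ^ p.τ * ‖hI‖ ^ 2)

/-- The squared power constraint factor of the MRC/MRT relay. -/
def gainSq : ℝ :=
  p.relayPower h₁ hI /
    ((1 - p.θ) * p.Ps / p.d₁ ^ p.τ * ‖h₁‖ ^ 2 +
      (1 - p.θ) * p.PI / p.dI ^ p.τ * (‖inner ℂ h₁ hI‖ ^ 2 / ‖h₁‖ ^ 2) + p.N₀)

/-- The MRC/MRT relay matrix `W = ω h₂† h₁† / (‖h₂‖ ‖h₁‖)` (`h₂` is a row, `h₁` a column). -/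
def relayMatrix : Matrix (Fin N) (Fin N) ℂ :=
  ((Real.sqrt (p.gainSq h₁ hI) / (‖h₂‖ * ‖h₁‖) : ℝ) : ℂ) •
    Matrix.vecMulVec (star h₂.ofLp) (star h₁.ofLp)

/-- The end-to-end SINR at the destination when the relay applies the matrix `W`. -/
def sinrOf (W : Matrix (Fin N) (Fin N) ℂ) : ℝ :=
  ((1 - p.θ) * p.Ps / (p.d₁ ^ p.τ * p.d₂ ^ p.τ) * ‖h₂.ofLp ⬝ᵥ W.mulVec h₁.ofLp‖ ^ 2) /
    ((1 - p.θ) * p.PI / (p.dI ^ p.τ * p.d₂ ^ p.τ) * ‖h₂.ofLp ⬝ᵥ W.mulVec hI.ofLp‖ ^ 2 +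
      ‖WithLp.toLp 2 (W.vecMul h₂.ofLp)‖ ^ 2 / p.d₂ ^ p.τ * p.N₀ + p.N₀)

/-- The end-to-end SINR of the MRC/MRT scheme. -/
def sinr : ℝ := p.sinrOf h₁ hI h₂ (p.relayMatrix h₁ hI h₂)

/-- The SINR `γ_{I1}` of the first hop of the MRC/MRT scheme. -/
def sinr₁ : ℝ :=
  ((1 - p.θ) * p.ρ₁ / p.d₁ ^ p.τ * ‖h₁‖ ^ 2) /
    ((1 - p.θ) * p.ρI / p.dI ^ p.τ * (‖inner ℂ h₁ hI‖ ^ 2 / ‖h₁‖ ^ 2) + 1)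

/-- The SNR `γ_{I2}` of the second hop of the MRC/MRT scheme. -/
def sinr₂ : ℝ :=
  p.η * p.θ / p.d₂ ^ p.τ *
    (p.ρ₁ / p.d₁ ^ p.τ * ‖h₁‖ ^ 2 + p.ρI / p.dI ^ p.τ * ‖hI‖ ^ 2) * ‖h₂‖ ^ 2

end Params

/-- The law `CN(0,1)`: independent real and imaginary parts, each `N(0, 1/2)`. -/
def stdComplexGaussian : Measure ℂ :=
  ((gaussianReal 0 (1 / 2)).prod (gaussianReal 0 (1 / 2))).map fun x : ℝ × ℝ => (⟨x.1, x.2⟩ : ℂ)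

/-- Rayleigh fading: all entries of the three channel vectors are i.i.d. `CN(0,1)`. -/
structure RayleighFading {Ω : Type*} [MeasurableSpace Ω] (P : Measure Ω) {N : ℕ}
    (h₁ hI h₂ : Ω → EuclideanSpace ℂ (Fin N)) : Prop where
  law : ∀ (k : Fin 3) (i : Fin N),
    HasLaw (fun ω => (![h₁ ω, hI ω, h₂ ω] k).ofLp i) stdComplexGaussian P
  indep : iIndepFun (fun (q : Fin 3 × Fin N) (ω : Ω) => (![h₁ ω, hI ω, h₂ ω] q.1).ofLp q.2) P

/-- The ergodic capacity `½ E[log₂(1 + γ)]` of a two-slot link with random SNR `γ`. -/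
def ergodicCapacity {Ω : Type*} [MeasurableSpace Ω] (P : Measure Ω) (γ : Ω → ℝ) : ℝ :=
  1 / 2 * ∫ ω, Real.logb 2 (1 + γ ω) ∂P

/-! ### The closed-form terms of the bound -/

namespace Params

variable (N : ℕ) (p : Params)

/-- The closed form of `C_{γ_{I1}}`. -/
def capTerm₁ : ℂ :=
  (((1 - p.θ) * p.ρ₁ / (2 * p.d₁ ^ p.τ * Real.log 2) : ℝ) : ℂ) *
    ∑ m ∈ Finset.range N, ∑ n ∈ Finset.range (m + 1),
      ((((1 - p.θ) * p.ρI) ^ n / ((p.dI ^ p.τ) ^ n * (m - n)! * n !) : ℝ) : ℂ) *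
        bivariateMeijerG ((m : ℂ) + 1) 0 (-(n : ℂ)) 0 0
          (((1 - p.θ) * p.ρ₁ / p.d₁ ^ p.τ : ℝ) : ℂ) (((1 - p.θ) * p.ρI / p.dI ^ p.τ : ℝ) : ℂ)

/-- `∏_{j=1}^{s-1} (1 - N - j)`. -/
def coef (s : ℕ) : ℝ := ∏ j ∈ Finset.Icc 1 (s - 1), (1 - (N : ℝ) - (j : ℝ))

/-- The function `G_{1,3}^{3,1}(z | s-N-1 ; s-N-1, m+s-N-1, 0)`. -/
def hopG (s m : ℕ) (z : ℝ) : ℂ :=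
  meijerG [(s : ℂ) - N - 1] [] [(s : ℂ) - N - 1, (m : ℂ) + s - N - 1, 0] [] (z : ℂ)

/-- The closed form of `C_{γ_{I2}}`. -/
def capTerm₂ : ℂ :=
  (((p.d₁ ^ p.τ) ^ N * (p.dI ^ p.τ) ^ N / (p.ρ₁ ^ N * p.ρI ^ N * (2 * Real.log 2)) : ℝ) : ℂ) *
      ∑ s ∈ Finset.Icc 1 N,
        ((coef N s / ((N - s)! * (s - 1)!) *
            (p.dI ^ p.τ / p.ρI - p.d₁ ^ p.τ / p.ρ₁) ^ (1 - (N : ℤ) - (s : ℤ)) : ℝ) : ℂ) *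
          ∑ m ∈ Finset.range N,
            ((1 / (m ! : ℝ) * (p.d₂ ^ p.τ / (p.η * p.θ)) ^ (N + 1 - s) : ℝ) : ℂ) *
              hopG N s m (p.d₁ ^ p.τ * p.d₂ ^ p.τ / (p.η * p.θ * p.ρ₁)) +
    (((p.d₁ ^ p.τ) ^ N * (p.dI ^ p.τ) ^ N / (p.ρ₁ ^ N * p.ρI ^ N * (2 * Real.log 2)) : ℝ) : ℂ) *
      ∑ s ∈ Finset.Icc 1 N,
        ((coef N s / ((N - s)! * (s - 1)!) *
            (p.d₁ ^ p.τ / p.ρ₁ - p.dI ^ p.τ / p.ρI) ^ (1 - (N : ℤ) - (s : ℤ)) : ℝ) : ℂ) *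
          ∑ m ∈ Finset.range N,
            ((1 / (m ! : ℝ) * (p.d₂ ^ p.τ / (p.η * p.θ)) ^ (N + 1 - s) : ℝ) : ℂ) *
              hopG N s m (p.d₂ ^ p.τ * p.dI ^ p.τ / (p.η * p.θ * p.ρI))

/-- The closed form of `E[ln γ_{I1}]`. -/
def logTerm₁ : ℂ :=
  ((Real.log ((1 - p.θ) * p.ρ₁) - Real.log (p.d₁ ^ p.τ) : ℝ) : ℂ) + Complex.digamma 1 -
      ((Real.exp (p.dI ^ p.τ / ((1 - p.θ) * p.ρI)) : ℝ) : ℂ) *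
        meijerG [] [1, 1] [0, 0, 1] [] ((p.dI ^ p.τ / ((1 - p.θ) * p.ρI) : ℝ) : ℂ) +
    ∑ m ∈ Finset.Icc 1 (N - 1), ∑ n ∈ Finset.range (m + 1),
      ((((1 - p.θ) * p.ρI) ^ ((n : ℤ) - (m : ℤ)) /
          ((m - n)! * (p.dI ^ p.τ) ^ ((n : ℤ) - (m : ℤ))) *
        Real.Gamma m * tricomi m ((m : ℝ) - n) (p.dI ^ p.τ / ((1 - p.θ) * p.ρI)) : ℝ) : ℂ)

/-- The closed form of `E[ln γ_{I2}]`. -/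
def logTerm₂ : ℂ :=
  ((Real.log (p.η * p.θ) - Real.log (p.d₂ ^ p.τ) : ℝ) : ℂ) + Complex.digamma (N : ℂ) +
    (((p.dI ^ p.τ) ^ N / p.ρI ^ N : ℝ) : ℂ) *
      ∑ s ∈ Finset.Icc 1 N,
        ((coef N s / (s - 1)! *
            (p.dI ^ p.τ / p.ρI - p.d₁ ^ p.τ / p.ρ₁) ^ (1 - (N : ℤ) - (s : ℤ)) *
            (p.ρ₁ / p.d₁ ^ p.τ) ^ (1 - (s : ℤ)) : ℝ) : ℂ) *
          (Complex.digamma ((N : ℂ) - s + 1) +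
            ((Real.log p.ρ₁ - Real.log (p.d₁ ^ p.τ) : ℝ) : ℂ)) +
    (((p.d₁ ^ p.τ) ^ N / p.ρ₁ ^ N : ℝ) : ℂ) *
      ∑ s ∈ Finset.Icc 1 N,
        ((coef N s / (s - 1)! *
            (p.d₁ ^ p.τ / p.ρ₁ - p.dI ^ p.τ / p.ρI) ^ (1 - (N : ℤ) - (s : ℤ)) *
            (p.ρI / p.dI ^ p.τ) ^ (1 - (s : ℤ)) : ℝ) : ℂ) *
          (Complex.digamma ((N : ℂ) - s + 1) +
            ((Real.log p.ρI - Real.log (p.dI ^ p.τ) : ℝ) : ℂ))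

/-- The closed-form upper bound (the four closed forms are real numbers, written in `ℂ`). -/
def capacityBound : ℝ :=
  (p.capTerm₁ N).re + (p.capTerm₂ N).re -
    1 / 2 * Real.logb 2 (1 + Real.exp (p.logTerm₁ N).re + Real.exp (p.logTerm₂ N).re)

end Params

end EHRelay

end

/-! ### Gamma function on vertical lines and superposition of Mellin–Barnes integrals -/

namespace EHRelay
open Complex Set Filter Topology

/-! The bound comes from the identity `(1 + x)(1 + y) = (1 + x + y)(1 + xy/(x + y + 1))`. With `x`,
`y` the two hop SNRs it writes the logarithm of the end-to-end link as the two hop logarithms minus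
`log (1 + x + y)`. The function `(u, v) ↦ log (1 + e^u + e^v)` is convex, so Jensen's inequality at
`u = log x`, `v = log y` bounds the expectation of the subtracted term from below
(`log_one_add_exp_integral_le`, `ergodicCapacity_harmonic_le`). Independence of the two hops is not
needed, and indeed both contain `‖h₁‖²`. The algebra behind the end-to-end ratio is `sinr_eq`.

What remains is to evaluate four expectations. The squared norms of the channels are independent
Erlang variables of shape `N`. Given `h₁`, the projected interference `|h₁† hI|² / ‖h₁‖²` is
exponential with a law that does not depend on `h₁`, so it is independent of `‖h₁‖²`
(`measurePreserving_firstHop`). Integration by parts turns the mean of `log (1 + cX)` for an Erlang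
`X` into rational-times-exponential integrals (`integral_log_one_add_mul_erlang`), and the mean of
`log X` is a digamma value. For the second hop the characteristic function of `aX + bZ` is expanded
in partial fractions whose coefficients come from the Chaundy–Bullard identity. The law of `aX + bZ`
is thereby a signed mixture of scaled Erlang laws, and expectations may be computed term by term
(`integral_linearComb_erlang`). This is where `a ≠ b` enters.

The special functions are reduced to the same real integrals by one mechanism: the Cahen–Mellin
formula represents `e^{-x}` by the kernel `Γ(-s)`, and every further Gamma factor is an average over
the argument `x`, pulled through the contour integral by Fubini (`integral_kernel_mul_integral`). -/

lemma norm_Gamma_le {s : ℂ} (hs : 0 < s.re) : ‖Gamma s‖ ≤ Real.Gamma s.re := by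
  rw [Complex.Gamma_eq_integral hs, Real.Gamma_eq_integral hs, GammaIntegral]
  refine (norm_integral_le_integral_norm _).trans (le_of_eq ?_)
  refine setIntegral_congr_fun measurableSet_Ioi fun t ht => ?_
  simp only [norm_mul, Complex.norm_cpow_eq_rpow_re_of_pos ht, Complex.norm_real, sub_re, one_re,
    Real.norm_eq_abs, abs_of_pos (Real.exp_pos _)]

lemma continuous_Gamma_verticalLine {σ : ℝ} (hσ : 0 < σ) (ε : ℝ) :
    Continuous fun y : ℝ => Gamma (σ + (ε * y : ℝ) * I) := by
  refine continuous_iff_continuousAt.2 fun y => ?_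
  have h : ContinuousAt Gamma (σ + (ε * y : ℝ) * I) := by
    refine (differentiableAt_Gamma _ fun m hm => ?_).continuousAt
    have := congrArg re hm
    simp at this
    have : (0:ℝ) ≤ m := m.cast_nonneg
    linarith
  exact ContinuousAt.comp (f := fun y : ℝ => (σ + (ε * y : ℝ) * I : ℂ)) h (by fun_prop)

/-- Two applications of the functional equation give `Γ(s) = Γ(s + 2) / (s (s + 1))`. The numerator
is bounded on the line and the denominator grows quadratically, which is just enough decay for
integrability. -/
lemma norm_Gamma_verticalLine_le {σ : ℝ} (hσ : 0 < σ) (y : ℝ) :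
    ‖Gamma (σ + y * I)‖ ≤ Real.Gamma (σ + 2) / min 1 (σ ^ 2) * (1 + y ^ 2)⁻¹ := by
  set s : ℂ := σ + y * I with hs
  have hre : s.re = σ := by simp [hs]
  have him : s.im = y := by simp [hs]
  have h0 : s ≠ 0 := fun h => by rw [h] at hre; simp at hre; linarith
  have h1 : s + 1 ≠ 0 := fun h => by
    have := congrArg re h
    simp [hre] at this; linarith
  have e : Gamma (s + 2) = (s + 1) * (s * Gamma s) := by
    rw [show s + 2 = (s + 1) + 1 by ring, Gamma_add_one _ h1, Gamma_add_one _ h0]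
  have hG : ‖Gamma (s + 2)‖ ≤ Real.Gamma (σ + 2) := by
    have := norm_Gamma_le (s := s + 2) (by simp [hre]; linarith)
    simpa [hre] using this
  have hm : 0 < min 1 (σ ^ 2) := lt_min one_pos (by positivity)
  have n0 : min 1 (σ ^ 2) * (1 + y ^ 2) ≤ ‖s‖ ^ 2 := by
    rw [← Complex.normSq_eq_norm_sq, Complex.normSq_apply, hre, him]
    nlinarith [min_le_left 1 (σ ^ 2), min_le_right 1 (σ ^ 2), sq_nonneg y]
  have n1 : ‖s‖ ≤ ‖s + 1‖ := by
    refine le_of_sq_le_sq ?_ (norm_nonneg _)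
    rw [← Complex.normSq_eq_norm_sq, ← Complex.normSq_eq_norm_sq, Complex.normSq_apply,
      Complex.normSq_apply]
    simp [hre, him]; nlinarith
  rw [div_mul_eq_mul_div, ← div_eq_mul_inv, div_div, le_div_iff₀ (by positivity)]
  refine le_trans ?_ hG
  rw [e, norm_mul, norm_mul]
  have := norm_nonneg (Gamma s)
  have h2 : (1 + y ^ 2) * min 1 (σ ^ 2) ≤ ‖s + 1‖ * ‖s‖ := by nlinarith [norm_nonneg s]
  nlinarith

lemma integrable_Gamma_verticalLine {σ : ℝ} (hσ : 0 < σ) :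
    Integrable fun y : ℝ => Gamma (σ + y * I) := by
  refine (integrable_inv_one_add_sq.const_mul (Real.Gamma (σ + 2) / min 1 (σ ^ 2))).mono'
    (by simpa using (continuous_Gamma_verticalLine hσ 1).aestronglyMeasurable)
    (ae_of_all _ fun y => norm_Gamma_verticalLine_le hσ y)

/-- The Cahen–Mellin integral, over a line to the left of the origin. -/
lemma integral_Gamma_neg_mul_cpow {c : ℝ} (hc : c < 0) {x : ℝ} (hx : 0 < x) :
    ∫ y : ℝ, Gamma (-(c + y * I)) * (x : ℂ) ^ ((c : ℂ) + y * I) =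
      ((2 * Real.pi * Real.exp (-x) : ℝ) : ℂ) := by
  have hσ : 0 < -c := by linarith
  have hm : ∀ s : ℂ, 0 < s.re → mellin (fun t : ℝ => ((Real.exp (-t) : ℝ) : ℂ)) s = Gamma s :=
    fun s hs => by rw [Complex.Gamma_eq_integral hs, ← GammaIntegral_eq_mellin]
  have hline : (fun y : ℝ => mellin (fun t : ℝ => ((Real.exp (-t) : ℝ) : ℂ)) (((-c : ℝ) : ℂ) + y * I)) =
      fun y : ℝ => Gamma (((-c : ℝ) : ℂ) + y * I) := funext fun y => hm _ (by simp; linarith)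
  -- Mellin inversion for `e^{-t}` on the line of abscissa `-c > 0`; the reflection `y ↦ -y` below
  -- turns `x^{-s} Γ(s)` into the form with `x^s Γ(-s)`.
  have key := mellinInv_mellin_eq (-c) (fun t : ℝ => ((Real.exp (-t) : ℝ) : ℂ)) hx
    (by
      have := GammaIntegral_convergent (s := ((-c : ℝ) : ℂ)) (by simpa using hσ)
      refine this.congr (ae_of_all _ fun t => ?_)
      simp [mul_comm])
    (by
      unfold VerticalIntegrable
      rw [hline]
      exact integrable_Gamma_verticalLine hσ)
    (by fun_prop)
  rw [mellinInv] at key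
  have e2 : (fun y : ℝ => (x : ℂ) ^ (-(((-c : ℝ) : ℂ) + y * I)) •
      mellin (fun t : ℝ => ((Real.exp (-t) : ℝ) : ℂ)) (((-c : ℝ) : ℂ) + y * I)) =
      fun y : ℝ => (x : ℂ) ^ (-(((-c : ℝ) : ℂ) + y * I)) * Gamma (((-c : ℝ) : ℂ) + y * I) := by
    funext y; rw [congrFun hline y, smul_eq_mul]
  rw [e2] at key
  rw [← integral_neg_eq_self]
  have e3 : (fun y : ℝ => Gamma (-((c : ℂ) + (-y : ℝ) * I)) * (x : ℂ) ^ ((c : ℂ) + (-y : ℝ) * I)) =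
      fun y : ℝ => (x : ℂ) ^ (-(((-c : ℝ) : ℂ) + y * I)) * Gamma (((-c : ℝ) : ℂ) + y * I) := by
    funext y
    rw [mul_comm]
    congr 2 <;> push_cast <;> ring
  rw [e3]
  have hpi : (2 * Real.pi : ℝ) ≠ 0 := by positivity
  rw [one_div, inv_smul_eq_iff₀ hpi] at key
  rw [key, Complex.real_smul, ← Complex.ofReal_mul]

section Kernel

variable {α : Type*} [MeasurableSpace α] {μ : Measure α}

/-- Superposition of a Mellin–Barnes integral over the argument. -/
lemma integral_kernel_mul_integral [SFinite μ] {K : ℂ → ℂ} {c : ℝ} {F : ℝ → ℂ}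
    (hK : Integrable fun y : ℝ => K (c + y * I))
    (hF : ∀ x : ℝ, 0 < x → ∫ y : ℝ, K (c + y * I) * (x : ℂ) ^ ((c : ℂ) + y * I) = F x)
    {T : α → ℝ} (hT : Measurable T) (hpos : ∀ᵐ a ∂μ, 0 < T a) {g : α → ℂ}
    (hgm : AEStronglyMeasurable g μ) (hg : Integrable (fun a => ((T a ^ c : ℝ) : ℂ) * g a) μ) :
    ∫ y : ℝ, K (c + y * I) * ∫ a, (T a : ℂ) ^ ((c : ℂ) + y * I) * g a ∂μ =
      ∫ a, F (T a) * g a ∂μ := by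
  -- The modulus of `T^(c + iy)` is `T^c` for every `y`, so the integrand has the norm of a product
  -- of two integrable functions and Fubini applies.
  have hint : Integrable (fun q : ℝ × α => K (c + q.1 * I) *
      ((T q.2 : ℂ) ^ ((c : ℂ) + q.1 * I) * g q.2)) (volume.prod μ) := by
    refine (hK.mul_prod hg).mono ?_ ?_
    · refine AEStronglyMeasurable.mul hK.aestronglyMeasurable.comp_fst
        (AEStronglyMeasurable.mul (Measurable.aestronglyMeasurable ?_) hgm.comp_snd)
      exact (measurable_ofReal.comp (hT.comp measurable_snd)).pow (by fun_prop)
    · have : ∀ᵐ q : ℝ × α ∂(volume.prod μ), 0 < T q.2 :=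
        Measure.quasiMeasurePreserving_snd.ae hpos
      filter_upwards [this] with q hq
      rw [norm_mul, norm_mul, norm_mul, norm_mul, Complex.norm_cpow_eq_rpow_re_of_pos hq,
        Complex.norm_real, Real.norm_eq_abs, abs_of_pos (Real.rpow_pos_of_pos hq _)]
      simp
  simp_rw [← integral_const_mul]
  rw [integral_integral_swap hint]
  refine integral_congr_ae ?_
  filter_upwards [hpos] with a ha
  simp_rw [← mul_assoc]
  rw [integral_mul_const, hF _ ha]

end Kernel

end EHRelay

/-! ### The two-variable G-function as a real integral -/

namespace EHRelay
open Complex Set Filter Topology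

/-- Read from right to left: an extra factor `Γ(a + 1 + s)` in a Mellin–Barnes kernel is an average
of `(x t)^s` over `t`, the shape required by `integral_kernel_mul_integral`. -/
lemma integral_mul_cpow_mul_exp {x : ℝ} (hx : 0 < x) {a s : ℂ} (h : 0 < (a + 1 + s).re) :
    ∫ t in Ioi (0:ℝ), ((x * t : ℝ) : ℂ) ^ s * ((t : ℂ) ^ a * Real.exp (-t)) =
      (x : ℂ) ^ s * Gamma (a + 1 + s) := by
  rw [Complex.Gamma_eq_integral h, GammaIntegral, ← integral_const_mul]
  refine setIntegral_congr_fun measurableSet_Ioi fun t (ht : 0 < t) => ?_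
  have ht' : (t : ℂ) ≠ 0 := ofReal_ne_zero.2 ht.ne'
  rw [ofReal_mul, Complex.mul_cpow_ofReal_nonneg hx.le ht.le,
    show a + 1 + s - 1 = s + a by ring, Complex.cpow_add _ _ ht']
  ring

lemma integrableOn_rpow_mul_exp {q : ℝ} (hq : -1 < q) :
    IntegrableOn (fun t : ℝ => t ^ q * Real.exp (-t)) (Ioi 0) := by
  have := Real.GammaIntegral_convergent (s := q + 1) (by linarith)
  simpa [mul_comm] using this

lemma integrable_Gamma_mul_Gamma_neg {b c : ℝ} (h1 : -b < c) (h2 : c < 0) :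
    Integrable fun y : ℝ => Gamma (b + (c + y * I)) * Gamma (-(c + y * I)) := by
  have i1 : Integrable fun y : ℝ => Gamma (-(c + y * I)) := by
    have := (integrable_Gamma_verticalLine (σ := -c) (by linarith)).comp_neg
    refine this.congr (ae_of_all _ fun y => ?_)
    simp only; congr 1; push_cast; ring
  have hb : 0 < b + c := by linarith
  refine i1.bdd_mul (c := Real.Gamma (b + c)) ?_ (ae_of_all _ fun y => ?_)
  · have := (continuous_Gamma_verticalLine hb 1).aestronglyMeasurable (μ := volume)
    simpa [add_assoc] using this
  · simpa using norm_Gamma_le (s := b + (c + y * I)) (by simpa using hb)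

/-- Averaging the Cahen–Mellin formula at `x t` against `t^n e^{-t}` inserts the second Gamma factor
and replaces `e^{-x}` by `∫ t^n e^{-(1 + x) t} dt`. -/
lemma integral_Gamma_mul_Gamma_neg_mul_cpow (n : ℕ) {c : ℝ} (h1 : -((n:ℝ) + 1) < c) (h2 : c < 0)
    {x : ℝ} (hx : 0 < x) :
    ∫ y : ℝ, (Gamma (((n:ℝ) + 1 : ℝ) + (c + y * I)) * Gamma (-(c + y * I))) *
        (x : ℂ) ^ ((c : ℂ) + y * I) =
      ((2 * Real.pi * n ! / (1 + x) ^ (n + 1) : ℝ) : ℂ) := by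
  have key := integral_kernel_mul_integral (μ := volume.restrict (Ioi (0:ℝ)))
    (K := fun s => Gamma (-s)) (c := c) (F := fun x => ((2 * Real.pi * Real.exp (-x) : ℝ) : ℂ))
    (by
      have := (integrable_Gamma_verticalLine (σ := -c) (by linarith)).comp_neg
      refine this.congr (ae_of_all _ fun y => ?_)
      simp only; congr 1; push_cast; ring)
    (fun x hx => integral_Gamma_neg_mul_cpow h2 hx) (T := fun t => x * t) (by fun_prop)
    (by filter_upwards [ae_restrict_mem measurableSet_Ioi] with t (ht : 0 < t); positivity)
    (g := fun t => (t : ℂ) ^ (n : ℂ) * Real.exp (-t)) (by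
      refine Measurable.aestronglyMeasurable ?_
      fun_prop)
    (by
      have := (integrableOn_rpow_mul_exp (q := c + n) (by linarith)).const_mul (x ^ c)
      refine this.ofReal (𝕜 := ℂ) |>.congr ?_
      filter_upwards [ae_restrict_mem measurableSet_Ioi] with t (ht : 0 < t)
      rw [Real.rpow_add ht, Real.rpow_natCast, Real.mul_rpow hx.le ht.le]
      simp; ring)
  have e : ∀ y : ℝ, Gamma (-((c:ℂ) + y * I)) * ∫ t in Ioi (0:ℝ), ((x * t : ℝ) : ℂ) ^ ((c:ℂ) + y * I) *
      ((t : ℂ) ^ (n : ℂ) * Real.exp (-t)) =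
      (Gamma (((n:ℝ) + 1 : ℝ) + (c + y * I)) * Gamma (-(c + y * I))) *
        (x : ℂ) ^ ((c : ℂ) + y * I) := fun y => by
    rw [integral_mul_cpow_mul_exp hx (by simp; linarith)]
    push_cast; ring
  simp_rw [e] at key
  rw [key]
  have h1x : 0 < 1 + x := by linarith
  have g := Real.integral_rpow_mul_exp_neg_mul_Ioi (a := n + 1) (by positivity) h1x
  rw [show 2 * Real.pi * n ! / (1 + x) ^ (n + 1) = 2 * Real.pi * ((1 / (1 + x)) ^ ((n:ℝ) + 1) *
    Real.Gamma (n + 1)) by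
      rw [Real.Gamma_nat_eq_factorial, ← Nat.cast_succ, Real.rpow_natCast, one_div, inv_pow]; field_simp, ← g,
    ← integral_const_mul, ← integral_complex_ofReal]
  refine setIntegral_congr_fun measurableSet_Ioi fun t (ht : 0 < t) => ?_
  simp only [add_sub_cancel_right, Real.rpow_natCast, Complex.cpow_natCast]
  rw [show -((1 + x) * t) = -(x * t) + -t by ring, Real.exp_add]
  push_cast; ring

lemma integrable_Gamma_mul_Gamma_neg_nat (n : ℕ) {c : ℝ} (h1 : -((n:ℝ) + 1) < c) (h2 : c < 0) :
    Integrable fun y : ℝ => Gamma (((n:ℝ) + 1 : ℝ) + (c + y * I)) * Gamma (-(c + y * I)) :=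
  integrable_Gamma_mul_Gamma_neg h1 h2

/-- Only `Γ(m + 1 + s + t)` couples the two contour variables. Written as a Gamma integral over a
real variable it factors, and the two separate contour integrals become `1 / (1 + x t)` and `n! / (1
+ y t)^(n + 1)`. -/
lemma bivariateMeijerG_eq (m n : ℕ) {x y : ℝ} (hx : 0 < x) (hy : 0 < y) :
    bivariateMeijerG ((m : ℂ) + 1) 0 (-(n : ℂ)) 0 0 x y =
      ((n ! * ∫ t in Ioi (0:ℝ), t ^ m * Real.exp (-t) / ((1 + x * t) * (1 + y * t) ^ (n + 1)) : ℝ) : ℂ) := by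
  have hex : ∃ c : ℝ × ℝ, BivariateSeparates ((m : ℂ) + 1) 0 (-(n : ℂ)) 0 0 c := by
    refine ⟨(-1/4, -1/4), ?_⟩
    have h1 : (0:ℝ) ≤ m := m.cast_nonneg
    have h2 : (0:ℝ) ≤ n := n.cast_nonneg
    refine ⟨?_, ?_, ?_, ?_, ?_⟩ <;> simp <;> linarith
  rw [bivariateMeijerG, dif_pos hex]
  obtain ⟨h1, h2, h3, h4, h5⟩ := hex.choose_spec
  -- From here on only the separation inequalities are known about the chosen lines, so the
  -- evaluation holds for any admissible pair.
  generalize hex.choose = c at *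
  obtain ⟨c, d⟩ := c
  simp only [Complex.zero_re, zero_sub, neg_re, natCast_re, add_re, one_re] at h1 h2 h3 h4 h5 ⊢
  have hpos : ∀ {z : ℝ}, 0 < z → ∀ᵐ t ∂(volume.restrict (Ioi (0:ℝ))), 0 < z * t := fun {z} hz => by
    filter_upwards [ae_restrict_mem measurableSet_Ioi] with t (ht : 0 < t); positivity
  -- The inner contour integral, for fixed `s`: the power `t^s` left over from the coupled factor is
  -- kept inside the weight, ready to serve as the argument of the outer one.
  have inner : ∀ u : ℝ, (∫ v : ℝ, bivariateKernel ((m : ℂ) + 1) 0 (-(n : ℂ)) 0 0 x y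
      ((c : ℂ) + u * I) ((d : ℂ) + v * I)) =
      (Gamma ((((0:ℕ):ℝ) + 1 : ℝ) + (c + u * I)) * Gamma (-(c + u * I))) *
        ∫ t in Ioi (0:ℝ), ((x * t : ℝ) : ℂ) ^ ((c : ℂ) + u * I) *
          ((2 * Real.pi * n ! / (1 + y * t) ^ (n + 1) * (t ^ m * Real.exp (-t)) : ℝ) : ℂ) := by
    intro u
    have key := integral_kernel_mul_integral (μ := volume.restrict (Ioi (0:ℝ)))
      (K := fun s => Gamma (((n:ℝ) + 1 : ℝ) + s) * Gamma (-s)) (c := d)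
      (F := fun x => ((2 * Real.pi * n ! / (1 + x) ^ (n + 1) : ℝ) : ℂ))
      (integrable_Gamma_mul_Gamma_neg_nat n (by linarith) h3)
      (fun x hx => integral_Gamma_mul_Gamma_neg_mul_cpow n (by linarith) h3 hx)
      (T := fun t => y * t) (by fun_prop) (hpos hy)
      (g := fun t => (t : ℂ) ^ ((m : ℂ) + (c + u * I)) * Real.exp (-t)) (by
        refine Measurable.aestronglyMeasurable ?_
        fun_prop)
      (by
        have := (integrableOn_rpow_mul_exp (q := d + (m + c)) (by linarith)).const_mul (y ^ d)
        refine this.mono' (Measurable.aestronglyMeasurable (by fun_prop)) ?_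
        filter_upwards [ae_restrict_mem measurableSet_Ioi] with t (ht : 0 < t)
        rw [norm_mul, norm_mul, Complex.norm_cpow_eq_rpow_re_of_pos ht, Complex.norm_real,
          Complex.norm_real, Real.norm_of_nonneg (by positivity),
          Real.norm_of_nonneg (Real.exp_pos _).le, Real.rpow_add ht, Real.mul_rpow hy.le ht.le]
        refine le_of_eq ?_
        simp; ring)
    have e : ∀ v : ℝ, bivariateKernel ((m : ℂ) + 1) 0 (-(n : ℂ)) 0 0 x y
        ((c : ℂ) + u * I) ((d : ℂ) + v * I) =
        (Gamma ((((0:ℕ):ℝ) + 1 : ℝ) + (c + u * I)) * Gamma (-(c + u * I)) * (x : ℂ) ^ ((c : ℂ) + u * I)) *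
        ((Gamma (((n:ℝ) + 1 : ℝ) + (d + v * I)) * Gamma (-(d + v * I))) *
        ∫ t in Ioi (0:ℝ), ((y * t : ℝ) : ℂ) ^ ((d : ℂ) + v * I) *
          ((t : ℂ) ^ ((m : ℂ) + (c + u * I)) * Real.exp (-t))) := by
      intro v
      rw [integral_mul_cpow_mul_exp hy (by simp; linarith), bivariateKernel,
        show (m:ℂ) + 1 + (c + u * I) + (d + v * I) = (m:ℂ) + (c + u * I) + 1 + (d + v * I) by ring]
      push_cast
      simp only [zero_sub, sub_neg_eq_add, sub_zero, zero_add]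
      rw [show (1 : ℂ) + n = n + 1 by ring]
      ring
    simp_rw [e]
    rw [integral_const_mul, key, mul_assoc, ← integral_const_mul (μ := volume.restrict (Ioi (0:ℝ)))]
    congr 1
    refine setIntegral_congr_fun measurableSet_Ioi fun t (ht : 0 < t) => ?_
    have ht' : (t : ℂ) ≠ 0 := ofReal_ne_zero.2 ht.ne'
    rw [ofReal_mul x t, Complex.mul_cpow_ofReal_nonneg hx.le ht.le, Complex.cpow_add _ _ ht',
      Complex.cpow_natCast]
    push_cast; ring
  simp_rw [inner]
  have key := integral_kernel_mul_integral (μ := volume.restrict (Ioi (0:ℝ)))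
    (K := fun s => Gamma ((((0:ℕ):ℝ) + 1 : ℝ) + s) * Gamma (-s)) (c := c)
    (F := fun x => ((2 * Real.pi * 0 ! / (1 + x) ^ (0 + 1) : ℝ) : ℂ))
    (integrable_Gamma_mul_Gamma_neg_nat 0 (by simpa using h2) h1)
    (fun x hx => integral_Gamma_mul_Gamma_neg_mul_cpow 0 (by simpa using h2) h1 hx)
    (T := fun t => x * t) (by fun_prop) (hpos hx)
    (g := fun t => ((2 * Real.pi * n ! / (1 + y * t) ^ (n + 1) * (t ^ m * Real.exp (-t)) : ℝ) : ℂ))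
    (by
      refine Measurable.aestronglyMeasurable ?_
      fun_prop)
    (by
      have := (integrableOn_rpow_mul_exp (q := c + m) (by
        have : (0:ℝ) ≤ m := m.cast_nonneg
        linarith)).const_mul (2 * Real.pi * n ! * x ^ c)
      refine this.mono' (Measurable.aestronglyMeasurable (by fun_prop)) ?_
      filter_upwards [ae_restrict_mem measurableSet_Ioi] with t (ht : 0 < t)
      rw [← ofReal_mul, Complex.norm_real, Real.norm_of_nonneg (by positivity), Real.rpow_add ht,
        Real.mul_rpow hx.le ht.le, Real.rpow_natCast]
      have : 2 * Real.pi * n ! / (1 + y * t) ^ (n + 1) ≤ 2 * Real.pi * n ! :=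
        div_le_self (by positivity) (one_le_pow₀ (by nlinarith))
      calc _ = (2 * Real.pi * n ! / (1 + y * t) ^ (n + 1)) * (x ^ c * t ^ c * (t ^ m * Real.exp (-t))) := by ring
        _ ≤ (2 * Real.pi * n !) * (x ^ c * t ^ c * (t ^ m * Real.exp (-t))) := by gcongr
        _ = _ := by ring)
  rw [key, ← integral_const_mul, ofReal_mul, ← integral_complex_ofReal, ← integral_const_mul]
  refine setIntegral_congr_fun measurableSet_Ioi fun t (ht : 0 < t) => ?_
  have a1 : (1 + x * t : ℝ) ≠ 0 := by positivity
  have a2 : (1 + y * t : ℝ) ≠ 0 := by positivity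
  norm_cast
  push_cast
  field_simp
  simp

end EHRelay

/-! ### The one-variable G-functions as real integrals -/

namespace EHRelay
open Complex Set Filter Topology

/-- The kernel collapses to `Γ(-s) · (-1/s)`, and `-1/s = ∫_1^∞ t^{s-1} dt` on the line `Re s < 0`.
Hence the function is the average of `e^{-z t}` against `dt / t` on `(1, ∞)`. -/
lemma meijerG_expIntegral {z : ℝ} (hz : 0 < z) :
    meijerG [] [1, 1] [0, 0, 1] [] z = ((∫ t in Ioi (1:ℝ), Real.exp (-(z * t)) / t : ℝ) : ℂ) := by
  have hex : ∃ c : ℝ, MeijerSeparates [] [0, 0, 1] c := ⟨-1, by simp [MeijerSeparates]⟩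
  rw [meijerG, dif_pos hex]
  have hc : hex.choose < 0 := by simpa using hex.choose_spec.1 0 (by simp)
  generalize hex.choose = c at *
  have e : ∀ y : ℝ, meijerKernel [] [1, 1] [0, 0, 1] [] z ((c : ℂ) + y * I) =
      Gamma (-(c + y * I)) * ∫ t in Ioi (1:ℝ), ((z * t : ℝ) : ℂ) ^ ((c : ℂ) + y * I) *
        ((t⁻¹ : ℝ) : ℂ) := by
    intro y
    set s : ℂ := c + y * I with hs
    have hre : s.re = c := by simp [hs]
    have hs0 : s ≠ 0 := fun h => by rw [h] at hre; simp at hre; linarith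
    have hi : ∫ t in Ioi (1:ℝ), ((z * t : ℝ) : ℂ) ^ s * ((t⁻¹ : ℝ) : ℂ) = (z : ℂ) ^ s * (-1 / s) := by
      have := integral_Ioi_cpow_of_lt (a := s - 1) (c := 1) (by simp [hre]; linarith) one_pos
      rw [sub_add_cancel, ofReal_one, one_cpow] at this
      rw [← this, ← integral_const_mul]
      refine setIntegral_congr_fun measurableSet_Ioi fun t (ht : 1 < t) => ?_
      have ht0 : 0 < t := by linarith
      rw [ofReal_mul, Complex.mul_cpow_ofReal_nonneg hz.le ht0.le,
        Complex.cpow_sub _ _ (ofReal_ne_zero.2 ht0.ne'), cpow_one, ofReal_inv]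
      ring
    rw [hi]
    have hG : Gamma (1 - s) = -s * Gamma (-s) := by
      rw [← Gamma_add_one _ (neg_ne_zero.2 hs0)]; congr 1; ring
    have hG0 : Gamma (-s) ≠ 0 := Gamma_ne_zero_of_re_pos (by simp [hre, hc])
    simp only [meijerKernel, List.map_cons, List.map_nil, List.prod_cons, List.prod_nil, mul_one,
      zero_sub, one_mul, hG]
    field_simp
  simp_rw [e]
  rw [integral_kernel_mul_integral (K := fun s => Gamma (-s))
    (F := fun x => ((2 * Real.pi * Real.exp (-x) : ℝ) : ℂ)) (by
      have := (integrable_Gamma_verticalLine (σ := -c) (by linarith)).comp_neg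
      refine this.congr (ae_of_all _ fun y => ?_)
      simp only; congr 1; push_cast; ring)
    (fun x hx => integral_Gamma_neg_mul_cpow hc hx) (T := fun t => z * t) (by fun_prop)
    (by filter_upwards [ae_restrict_mem measurableSet_Ioi] with t (ht : 1 < t); positivity)
    (by refine Measurable.aestronglyMeasurable ?_
        fun_prop)
    (by
      have := (integrableOn_Ioi_rpow_of_lt (a := c - 1) (by linarith) one_pos).const_mul (z ^ c)
      refine this.mono' (Measurable.aestronglyMeasurable (by fun_prop)) ?_
      filter_upwards [ae_restrict_mem measurableSet_Ioi] with t (ht : 1 < t)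
      have ht0 : 0 < t := by linarith
      rw [← ofReal_mul, Complex.norm_real, Real.norm_of_nonneg (by positivity),
        Real.mul_rpow hz.le ht0.le, Real.rpow_sub ht0, Real.rpow_one]
      exact le_of_eq (by ring))]
  rw [← integral_complex_ofReal, ← integral_const_mul]
  refine setIntegral_congr_fun measurableSet_Ioi fun t (ht : 1 < t) => ?_
  have hpi : (Real.pi : ℂ) ≠ 0 := ofReal_ne_zero.2 Real.pi_ne_zero
  push_cast
  field_simp

/-- Lebesgue measure on the open positive quadrant. -/
noncomputable abbrev quadrant : Measure (ℝ × ℝ) :=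
  (volume.restrict (Ioi (0:ℝ))).prod (volume.restrict (Ioi (0:ℝ)))

lemma quadrant_pos : ∀ᵐ q : ℝ × ℝ ∂quadrant, 0 < q.1 ∧ 0 < q.2 := by
  rw [quadrant, Measure.prod_restrict]
  filter_upwards [ae_restrict_mem (measurableSet_Ioi.prod measurableSet_Ioi)] with q hq
  exact hq

/-- After translating the contour by `r` the kernel is `Γ(1 + s) Γ(-s) · Γ(m - s) Γ(r - s) z^{s -
r}`. The first pair is the kernel of `1 / (1 + x)`, and the second pair averages it over `x = z /
(q₁ q₂)` on the quadrant. -/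
lemma meijerG_hop (m r : ℕ) (hr : 1 ≤ r) {z : ℝ} (hz : 0 < z) :
    meijerG [-(r : ℂ)] [] [-(r : ℂ), (m : ℂ) - r, 0] [] z =
      (((z ^ r)⁻¹ * ∫ q : ℝ × ℝ, q.1 ^ m * Real.exp (-q.1) * (q.2 ^ r * Real.exp (-q.2)) /
        (z + q.1 * q.2) ∂quadrant : ℝ) : ℂ) := by
  have hr1 : (1:ℝ) ≤ r := by exact_mod_cast hr
  have hm0 : (0:ℝ) ≤ m := m.cast_nonneg
  have hex : ∃ c : ℝ, MeijerSeparates [-(r : ℂ)] [-(r : ℂ), (m : ℂ) - r, 0] c := by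
    refine ⟨-r - 1/2, ?_, ?_⟩
    · simp only [List.mem_cons, List.not_mem_nil, or_false, forall_eq_or_imp, forall_eq, neg_re,
        natCast_re, sub_re, zero_re]
      refine ⟨?_, ?_, ?_⟩ <;> linarith
    · simp only [List.mem_cons, List.not_mem_nil, or_false, forall_eq, neg_re, natCast_re]
      linarith
  rw [meijerG, dif_pos hex]
  have hc1 : hex.choose < -r := by simpa using hex.choose_spec.1 (-(r:ℂ)) (by simp)
  have hc2 : -(r:ℝ) - 1 < hex.choose := by simpa using hex.choose_spec.2 (-(r:ℂ)) (by simp)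
  generalize hex.choose = c at *
  -- The separating strip `-r - 1 < c < -r` becomes `-1 < d < 0`.
  obtain ⟨d, rfl⟩ : ∃ d, c = d - r := ⟨c + r, by ring⟩
  have hd0 : d < 0 := by linarith
  have hd1 : -1 < d := by linarith
  have hz' : (z : ℂ) ≠ 0 := ofReal_ne_zero.2 hz.ne'
  -- The exponent `k - 1` is kept as `t^k / t`, since truncated subtraction would be wrong at `k =
  -- 0`; this case occurs for `m = 0`.
  have ft : ∀ (k : ℕ) {t : ℝ} {s : ℂ}, 0 < t → (t : ℂ) ^ ((k : ℂ) - 1 - s) =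
      (t : ℂ) ^ (-s) * ((t : ℂ) ^ k / t) := fun k t s ht => by
    have ht' : (t : ℂ) ≠ 0 := ofReal_ne_zero.2 ht.ne'
    rw [show (k : ℂ) - 1 - s = -s + k - 1 by ring, Complex.cpow_sub _ _ ht',
      Complex.cpow_add _ _ ht', Complex.cpow_natCast, cpow_one]
    ring
  have hΓ : ∀ (k : ℕ) {s : ℂ}, s.re = d → Gamma ((k : ℂ) - s) =
      ∫ t in Ioi (0:ℝ), (t : ℂ) ^ (-s) * ((t : ℂ) ^ k / t) * Real.exp (-t) := fun k s hs => by
    rw [Complex.Gamma_eq_integral (by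
      have : (0:ℝ) ≤ k := k.cast_nonneg
      simp [hs]; linarith), GammaIntegral]
    refine setIntegral_congr_fun measurableSet_Ioi fun t (ht : 0 < t) => ?_
    rw [← ft k ht, show (k:ℂ) - s - 1 = k - 1 - s by ring]
    ring
  have e : ∀ y : ℝ, meijerKernel [-(r : ℂ)] [] [-(r : ℂ), (m : ℂ) - r, 0] [] z
        (((d - r : ℝ) : ℂ) + y * I) =
      ((z : ℂ) ^ r)⁻¹ * ((Gamma ((((0:ℕ):ℝ) + 1 : ℝ) + (d + y * I)) * Gamma (-(d + y * I))) *
      ∫ q : ℝ × ℝ, ((z / (q.1 * q.2) : ℝ) : ℂ) ^ ((d : ℂ) + y * I) *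
        ((q.1 ^ m / q.1 * Real.exp (-q.1) * (q.2 ^ r / q.2 * Real.exp (-q.2)) : ℝ) : ℂ) ∂quadrant) := by
    intro y
    set s : ℂ := d + y * I with hs
    have hre : s.re = d := by simp [hs]
    have hi : ∫ q : ℝ × ℝ, ((z / (q.1 * q.2) : ℝ) : ℂ) ^ s *
        ((q.1 ^ m / q.1 * Real.exp (-q.1) * (q.2 ^ r / q.2 * Real.exp (-q.2)) : ℝ) : ℂ) ∂quadrant =
        (z : ℂ) ^ s * (Gamma (m - s) * Gamma (r - s)) := by
      rw [hΓ m hre, hΓ r hre, ← integral_prod_mul, ← integral_const_mul]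
      refine integral_congr_ae ?_
      filter_upwards [quadrant_pos] with q hq
      have hq1 : (q.1 : ℂ) ≠ 0 := ofReal_ne_zero.2 hq.1.ne'
      have hq2 : (q.2 : ℂ) ≠ 0 := ofReal_ne_zero.2 hq.2.ne'
      have hp : ((z / (q.1 * q.2) : ℝ) : ℂ) ^ s = (z : ℂ) ^ s * ((q.1 : ℂ) ^ (-s) * (q.2 : ℂ) ^ (-s)) := by
        have := hq.1
        have := hq.2
        rw [Complex.cpow_neg, Complex.cpow_neg, ← mul_inv,
          ← Complex.mul_cpow_ofReal_nonneg hq.1.le hq.2.le, ← ofReal_mul, eq_mul_inv_iff_mul_eq₀,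
          ← Complex.mul_cpow_ofReal_nonneg (by positivity) (by positivity), ← ofReal_mul]
        · congr 2; field_simp
        · rw [Ne, Complex.cpow_eq_zero_iff]
          exact fun h => ofReal_ne_zero.2 (by positivity) h.1
      rw [hp]
      push_cast
      ring
    rw [hi]
    have hw : (((d - r : ℝ) : ℂ) + y * I) = s - r := by rw [hs]; push_cast; ring
    rw [hw]
    simp only [meijerKernel, List.map_cons, List.map_nil, List.prod_cons, List.prod_nil, mul_one,
      div_one]
    rw [Complex.cpow_sub _ _ hz', Complex.cpow_natCast,
      show -(r:ℂ) - (s - r) = -s by ring, show (m:ℂ) - r - (s - r) = m - s by ring,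
      show 0 - (s - r) = r - s by ring, show 1 - -(r:ℂ) + (s - r) = 1 + s by ring]
    push_cast
    rw [zero_add]
    ring
  simp_rw [e]
  rw [integral_const_mul, integral_kernel_mul_integral
    (K := fun s => Gamma ((((0:ℕ):ℝ) + 1 : ℝ) + s) * Gamma (-s))
    (F := fun x => ((2 * Real.pi * 0 ! / (1 + x) ^ (0 + 1) : ℝ) : ℂ))
    (integrable_Gamma_mul_Gamma_neg_nat 0 (by simpa using hd1) hd0)
    (fun x hx => integral_Gamma_mul_Gamma_neg_mul_cpow 0 (by simpa using hd1) hd0 hx)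
    (T := fun q : ℝ × ℝ => z / (q.1 * q.2)) (by fun_prop)
    (by filter_upwards [quadrant_pos] with q hq
        have := hq.1; have := hq.2; positivity)
    (by refine Measurable.aestronglyMeasurable ?_
        fun_prop)
    (by
      have := ((integrableOn_rpow_mul_exp (q := m - 1 - d) (by linarith)).mul_prod
        (integrableOn_rpow_mul_exp (q := r - 1 - d) (by linarith))).const_mul (z ^ d)
      refine this.mono' (Measurable.aestronglyMeasurable (by fun_prop)) ?_
      filter_upwards [quadrant_pos] with q hq
      obtain ⟨hq1, hq2⟩ := hq
      rw [← ofReal_mul, Complex.norm_real, Real.norm_of_nonneg (by positivity),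
        Real.div_rpow hz.le (by positivity), Real.mul_rpow hq1.le hq2.le, Real.rpow_sub hq1,
        Real.rpow_sub hq1, Real.rpow_sub hq2, Real.rpow_sub hq2, Real.rpow_one, Real.rpow_one,
        Real.rpow_natCast, Real.rpow_natCast]
      exact le_of_eq (by field_simp))]
  rw [← integral_const_mul, ← integral_const_mul, ← integral_const_mul, ← integral_complex_ofReal]
  refine integral_congr_ae ?_
  filter_upwards [quadrant_pos] with q hq
  obtain ⟨hq1, hq2⟩ := hq
  have hpi := Real.pi_ne_zero
  rw [← ofReal_mul, ← ofReal_pow, ← ofReal_inv, ← ofReal_mul]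
  norm_cast
  rw [Nat.factorial_zero, zero_add, pow_one]
  have : z + q.1 * q.2 ≠ 0 := by positivity
  have : 1 + z / (q.1 * q.2) ≠ 0 := by positivity
  have e2 : 1 + z / (q.1 * q.2) = (z + q.1 * q.2) / (q.1 * q.2) := by field_simp; ring
  rw [e2]
  push_cast
  field_simp

lemma hopG_eq {N s : ℕ} (hs : s ≤ N) (m : ℕ) {z : ℝ} (hz : 0 < z) :
    Params.hopG N s m z = (((z ^ (N + 1 - s))⁻¹ * ∫ q : ℝ × ℝ, q.1 ^ m * Real.exp (-q.1) *
      (q.2 ^ (N + 1 - s) * Real.exp (-q.2)) / (z + q.1 * q.2) ∂quadrant : ℝ) : ℂ) := by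
  rw [← meijerG_hop m (N + 1 - s) (by omega) hz, Params.hopG, Nat.cast_sub (by omega)]
  have e1 : (s : ℂ) - N - 1 = -(((N + 1 : ℕ) : ℂ) - s) := by push_cast; ring
  have e2 : (m : ℂ) + s - N - 1 = m - (((N + 1 : ℕ) : ℂ) - s) := by push_cast; ring
  rw [e1, e2]

end EHRelay

/-! ### Erlang laws and their logarithmic expectations -/

namespace EHRelay
open Set Filter Topology

lemma integrableOn_pow_mul_exp_neg_mul (k : ℕ) {c : ℝ} (hc : 0 < c) :
    IntegrableOn (fun x : ℝ => x ^ k * Real.exp (-(c * x))) (Ioi 0) := by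
  have := integrableOn_rpow_mul_exp_neg_mul_rpow (s := k) (p := 1) (b := c)
    (by have : (0:ℝ) ≤ k := k.cast_nonneg
        linarith) one_pos hc
  simpa using this

lemma integral_pow_mul_exp_neg_mul (k : ℕ) {c : ℝ} (hc : 0 < c) :
    ∫ x in Ioi (0:ℝ), x ^ k * Real.exp (-(c * x)) = k ! / c ^ (k + 1) := by
  have := Real.integral_rpow_mul_exp_neg_mul_Ioi (a := k + 1) (by positivity) hc
  rw [Real.Gamma_nat_eq_factorial, ← Nat.cast_succ, Real.rpow_natCast] at this
  simp only [Nat.cast_succ, add_sub_cancel_right, Real.rpow_natCast] at this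
  rw [this, Nat.succ_eq_add_one, one_div, inv_pow]
  field_simp

lemma integrableOn_pow_mul_exp_neg (k : ℕ) :
    IntegrableOn (fun x : ℝ => x ^ k * Real.exp (-x)) (Ioi 0) := by
  simpa using integrableOn_pow_mul_exp_neg_mul k one_pos

lemma integral_pow_mul_exp_neg (k : ℕ) : ∫ x in Ioi (0:ℝ), x ^ k * Real.exp (-x) = k ! := by
  simpa using integral_pow_mul_exp_neg_mul k one_pos

/-- The Erlang law with shape `k + 1` and rate `1`. -/
noncomputable def erlang (k : ℕ) : Measure ℝ :=
  (volume.restrict (Ioi (0:ℝ))).withDensity fun x => ENNReal.ofReal (x ^ k * Real.exp (-x) / k !)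

lemma erlang_density_toReal (k : ℕ) {E : Type*} [NormedAddCommGroup E] [NormedSpace ℝ E] (f : ℝ → E) :
    (fun x => (ENNReal.ofReal (x ^ k * Real.exp (-x) / k !)).toReal • f x) =ᵐ[volume.restrict (Ioi (0:ℝ))]
      fun x => (x ^ k * Real.exp (-x) / k !) • f x := by
  filter_upwards [ae_restrict_mem measurableSet_Ioi] with x (hx : 0 < x)
  rw [ENNReal.toReal_ofReal (by positivity)]

lemma integral_erlang (k : ℕ) {E : Type*} [NormedAddCommGroup E] [NormedSpace ℝ E] (f : ℝ → E) :
    ∫ x, f x ∂erlang k = ∫ x in Ioi (0:ℝ), (x ^ k * Real.exp (-x) / k !) • f x := by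
  rw [erlang, integral_withDensity_eq_integral_toReal_smul (by fun_prop)
    (ae_of_all _ fun x => ENNReal.ofReal_lt_top), integral_congr_ae (erlang_density_toReal k f)]

lemma integrable_erlang_iff (k : ℕ) {E : Type*} [NormedAddCommGroup E] [NormedSpace ℝ E] {f : ℝ → E} :
    Integrable f (erlang k) ↔ IntegrableOn (fun x => (x ^ k * Real.exp (-x) / k !) • f x) (Ioi 0) := by
  rw [erlang, integrable_withDensity_iff_integrable_smul' (by fun_prop)
    (ae_of_all _ fun x => ENNReal.ofReal_lt_top), integrable_congr (erlang_density_toReal k f),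
    IntegrableOn]

lemma erlang_pos (k : ℕ) : ∀ᵐ x ∂erlang k, 0 < x :=
  (withDensity_absolutelyContinuous _ _).ae_le (ae_restrict_mem measurableSet_Ioi)

instance (k : ℕ) : IsProbabilityMeasure (erlang k) where
  measure_univ := by
    rw [erlang, withDensity_apply _ MeasurableSet.univ, Measure.restrict_univ,
      ← ofReal_integral_eq_lintegral_ofReal]
    · rw [integral_div, integral_pow_mul_exp_neg, div_self (by positivity), ENNReal.ofReal_one]
    · exact (integrableOn_pow_mul_exp_neg k).div_const _
    · filter_upwards [ae_restrict_mem measurableSet_Ioi] with x (hx : 0 < x)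
      simp only [Pi.zero_apply]
      positivity

lemma integrable_id_erlang (k : ℕ) : Integrable (fun x : ℝ => x) (erlang k) := by
  rw [integrable_erlang_iff]
  refine ((integrableOn_pow_mul_exp_neg (k + 1)).div_const (k ! : ℝ)).congr
    (ae_of_all _ fun x => ?_)
  simp only [smul_eq_mul]; ring

/-- The exponent `-1/2` gives a singularity at the origin that stays integrable against every Erlang
density, including shape one. -/
lemma abs_log_le {x : ℝ} (hx : 0 < x) : |Real.log x| ≤ x + 2 * x ^ (-(1/2) : ℝ) := by
  have h1 := Real.log_le_sub_one_of_pos hx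
  have h2 := Real.log_le_rpow_div (x := x⁻¹) (by positivity) (ε := 1/2) (by norm_num)
  rw [Real.log_inv, Real.inv_rpow hx.le, ← Real.rpow_neg hx.le] at h2
  have h3 : 0 < x ^ (-(1/2) : ℝ) := by positivity
  rw [abs_le]; constructor <;> linarith

lemma integrable_log_erlang (k : ℕ) : Integrable Real.log (erlang k) := by
  rw [integrable_erlang_iff]
  have h := ((integrableOn_pow_mul_exp_neg (k + 1)).add ((integrableOn_rpow_mul_exp
    (q := k + (-(1/2))) (by have : (0:ℝ) ≤ k := k.cast_nonneg
                            linarith)).const_mul 2)).div_const (k ! : ℝ)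
  refine Integrable.mono' h (Measurable.aestronglyMeasurable (by fun_prop)) ?_
  filter_upwards [ae_restrict_mem measurableSet_Ioi] with x (hx : 0 < x)
  rw [norm_smul, Real.norm_of_nonneg (by positivity), Real.norm_eq_abs]
  refine (mul_le_mul_of_nonneg_left (abs_log_le hx) (by positivity)).trans (le_of_eq ?_)
  simp only [Pi.add_apply]
  rw [Real.rpow_add hx, Real.rpow_natCast]
  ring

/-- Differentiating the Gamma integral at `k + 1` produces `∫ x^k log x e^{-x} dx`; dividing by `Γ(k
+ 1) = k!` is the logarithmic derivative. -/
lemma integral_log_erlang (k : ℕ) :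
    ((∫ x, Real.log x ∂erlang k : ℝ) : ℂ) = Complex.digamma ((k : ℂ) + 1) := by
  have hre : 0 < ((k : ℂ) + 1).re := by simp; positivity
  have hd := Complex.hasDerivAt_GammaIntegral hre
  have hev : Complex.Gamma =ᶠ[𝓝 ((k : ℂ) + 1)] Complex.GammaIntegral := by
    have : ∀ᶠ s : ℂ in 𝓝 ((k : ℂ) + 1), 0 < s.re :=
      Complex.continuous_re.continuousAt.eventually (lt_mem_nhds hre)
    filter_upwards [this] with s hs using Complex.Gamma_eq_integral hs
  rw [Complex.digamma_def, logDeriv_apply, hev.deriv_eq, hd.deriv, Complex.Gamma_nat_eq_factorial,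
    integral_erlang, ← integral_complex_ofReal, ← integral_div]
  refine setIntegral_congr_fun measurableSet_Ioi fun x (hx : 0 < x) => ?_
  simp only [smul_eq_mul, add_sub_cancel_right, Complex.cpow_natCast]
  push_cast; ring

lemma digamma_natCast_add_one (k : ℕ) :
    Complex.digamma ((k : ℂ) + 1) =
      Complex.digamma 1 + ∑ m ∈ Finset.Icc 1 k, ((1 / (m : ℝ) : ℝ) : ℂ) := by
  induction k with
  | zero => simp
  | succ k ih =>
    rw [Finset.sum_Icc_succ_top (by omega), ← add_assoc, ← ih, Nat.cast_succ,
      Complex.digamma_apply_add_one]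
    · push_cast; rw [one_div]
    · intro m hm
      have h := congrArg Complex.re hm
      simp at h
      have h1 : (0:ℝ) ≤ k := k.cast_nonneg
      have h2 : (0:ℝ) ≤ m := m.cast_nonneg
      linarith

lemma integrable_log_one_add_mul_erlang (k : ℕ) {c : ℝ} (hc : 0 ≤ c) :
    Integrable (fun x => Real.log (1 + c * x)) (erlang k) := by
  refine ((integrable_id_erlang k).const_mul c).mono'
    (Measurable.aestronglyMeasurable (by fun_prop)) ?_
  filter_upwards [erlang_pos k] with x hx
  have h0 : 0 ≤ c * x := by positivity
  rw [Real.norm_of_nonneg (Real.log_nonneg (by linarith))]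
  have := Real.log_le_sub_one_of_pos (x := 1 + c * x) (by linarith)
  linarith

lemma integrableOn_hop (m : ℕ) {c : ℝ} (hc : 0 ≤ c) :
    IntegrableOn (fun x : ℝ => c * x ^ m * Real.exp (-x) / (1 + c * x)) (Ioi 0) := by
  refine ((integrableOn_pow_mul_exp_neg m).const_mul c).mono'
    (Measurable.aestronglyMeasurable (by fun_prop)) ?_
  filter_upwards [ae_restrict_mem measurableSet_Ioi] with x (hx : 0 < x)
  rw [Real.norm_of_nonneg (by positivity), ← mul_assoc]
  exact div_le_self (by positivity) (by nlinarith)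

/-- The derivative of `-x^m e^{-x} / m!` is the difference of two consecutive Erlang densities, so
this primitive compares the logarithmic expectations of neighbouring shapes. At `m = 0` the term
with `x^(m - 1)` is killed by its factor `m`. -/
lemma hasDerivAt_pow_mul_exp_mul_log (m : ℕ) {c x : ℝ} (h : 0 < 1 + c * x) :
    HasDerivAt (fun x => -(x ^ m / m ! * Real.exp (-x) * Real.log (1 + c * x)))
      (x ^ m * Real.exp (-x) / m ! * Real.log (1 + c * x) -
        m * x ^ (m - 1) * Real.exp (-x) / m ! * Real.log (1 + c * x) -
        1 / m ! * (c * x ^ m * Real.exp (-x) / (1 + c * x))) x := by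
  have h1 : HasDerivAt (fun x : ℝ => x ^ m / m !) (m * x ^ (m - 1) / m !) x :=
    (hasDerivAt_pow m x).div_const _
  have h2 : HasDerivAt (fun x : ℝ => Real.exp (-x)) (-Real.exp (-x)) x := by
    simpa using (hasDerivAt_neg x).exp
  have h3 : HasDerivAt (fun x : ℝ => Real.log (1 + c * x)) (c / (1 + c * x)) x := by
    have := ((hasDerivAt_id x).const_mul c).const_add 1
    simpa using this.log h.ne'
  refine ((h1.mul h2).mul h3).neg.congr_deriv ?_
  simp only [Pi.mul_apply]
  field_simp
  ring

lemma tendsto_pow_mul_exp_mul_log (m : ℕ) {c : ℝ} (hc : 0 ≤ c) :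
    Tendsto (fun x => -(x ^ m / m ! * Real.exp (-x) * Real.log (1 + c * x))) atTop (𝓝 0) := by
  have h := (Real.tendsto_pow_mul_exp_neg_atTop_nhds_zero (m + 1)).const_mul (c / m !)
  rw [mul_zero] at h
  rw [← neg_zero]
  refine Tendsto.neg (squeeze_zero' ?_ ?_ h)
  · filter_upwards [eventually_ge_atTop 0] with x hx
    have h0 : 0 ≤ c * x := by positivity
    have := Real.log_nonneg (x := 1 + c * x) (by linarith)
    positivity
  · filter_upwards [eventually_ge_atTop 0] with x hx
    have h0 : 0 ≤ c * x := by positivity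
    have := Real.log_le_sub_one_of_pos (x := 1 + c * x) (by linarith)
    calc x ^ m / m ! * Real.exp (-x) * Real.log (1 + c * x)
        ≤ x ^ m / m ! * Real.exp (-x) * (c * x) := by gcongr; linarith
      _ = _ := by ring

/-- Integrating that primitive over the half-line expresses the increment from shape `m` to `m + 1`
as a single integral. The boundary terms vanish for `m ≥ 1` by the power of `x` and for `m = 0`
because `log 1 = 0`. -/
lemma integral_log_one_add_mul_erlang (k : ℕ) {c : ℝ} (hc : 0 ≤ c) :
    ∫ x, Real.log (1 + c * x) ∂erlang k = ∑ m ∈ Finset.range (k + 1),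
      1 / (m ! : ℝ) * ∫ x in Ioi (0:ℝ), c * x ^ m * Real.exp (-x) / (1 + c * x) := by
  have hi : ∀ m : ℕ, IntegrableOn (fun x : ℝ => x ^ m * Real.exp (-x) / m ! * Real.log (1 + c * x))
      (Ioi 0) := fun m => by
    simpa using (integrable_erlang_iff m).1 (integrable_log_one_add_mul_erlang m hc)
  have hd : ∀ m : ℕ, ∀ x ∈ Ici (0:ℝ), _ := fun m x (hx : 0 ≤ x) =>
    hasDerivAt_pow_mul_exp_mul_log m (c := c) (x := x) (by positivity)
  simp only [integral_erlang, smul_eq_mul]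
  induction k with
  | zero =>
    have hint : IntegrableOn (fun x : ℝ => x ^ 0 * Real.exp (-x) / 0 ! * Real.log (1 + c * x) -
        (0:ℕ) * x ^ (0 - 1) * Real.exp (-x) / 0 ! * Real.log (1 + c * x) -
        1 / 0 ! * (c * x ^ 0 * Real.exp (-x) / (1 + c * x))) (Ioi 0) := by
      have := (hi 0).sub ((integrableOn_hop 0 hc).const_mul (1 / (0 ! : ℝ)))
      refine this.congr (ae_of_all _ fun x => ?_)
      simp
    have := integral_Ioi_of_hasDerivAt_of_tendsto' (hd 0) hint (tendsto_pow_mul_exp_mul_log 0 hc)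
    simp only [Nat.cast_zero, zero_mul, zero_div, sub_zero] at this
    rw [integral_sub (hi 0) ((integrableOn_hop 0 hc).const_mul _), integral_const_mul] at this
    rw [zero_add, Finset.sum_range_one]
    simp at this ⊢
    linarith
  | succ k ih =>
    have e : ∀ x : ℝ, ((k + 1 : ℕ) : ℝ) * x ^ (k + 1 - 1) * Real.exp (-x) / (k + 1)! *
        Real.log (1 + c * x) = x ^ k * Real.exp (-x) / k ! * Real.log (1 + c * x) := fun x => by
      rw [Nat.factorial_succ, add_tsub_cancel_right]
      have : ((k + 1 : ℕ) : ℝ) ≠ 0 := by positivity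
      push_cast at this ⊢
      field_simp
    have hint : IntegrableOn (fun x : ℝ => x ^ (k + 1) * Real.exp (-x) / (k + 1)! * Real.log (1 + c * x) -
        ((k + 1 : ℕ) : ℝ) * x ^ (k + 1 - 1) * Real.exp (-x) / (k + 1)! * Real.log (1 + c * x) -
        1 / (k + 1)! * (c * x ^ (k + 1) * Real.exp (-x) / (1 + c * x))) (Ioi 0) := by
      simp only [e]
      exact ((hi (k + 1)).sub (hi k)).sub ((integrableOn_hop (k + 1) hc).const_mul _)
    have := integral_Ioi_of_hasDerivAt_of_tendsto' (hd (k + 1)) hint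
      (tendsto_pow_mul_exp_mul_log (k + 1) hc)
    simp only [e] at this
    rw [integral_sub (by exact (hi (k + 1)).sub (hi k)) ((integrableOn_hop (k + 1) hc).const_mul _),
      integral_sub (hi (k + 1)) (hi k), integral_const_mul] at this
    rw [Finset.sum_range_succ, ← ih]
    simp only [ne_eq, Nat.add_eq_zero_iff, one_ne_zero, and_false, not_false_eq_true, zero_pow,
      zero_div, zero_mul, neg_zero, sub_zero] at this
    linarith

end EHRelay

/-! ### Expectations of the two hops under Erlang laws -/

namespace EHRelay
open Set Filter Topology

lemma one_add_mul_pow_eq_sum (m : ℕ) (x : ℝ) :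
    (1 + x) ^ m = ∑ n ∈ Finset.range (m + 1), (m ! / (n ! * (m - n)!) : ℝ) * x ^ n := by
  rw [add_comm, add_pow]
  refine Finset.sum_congr rfl fun n hn => ?_
  rw [Nat.cast_choose ℝ (Finset.mem_range_succ_iff.1 hn), one_pow]
  ring

lemma integrableOn_one_add_mul_pow_mul_exp (m : ℕ) (B : ℝ) {c : ℝ} (hc : 0 < c) :
    IntegrableOn (fun y => (1 + B * y) ^ m * Real.exp (-(c * y))) (Ioi 0) := by
  have : (fun y => (1 + B * y) ^ m * Real.exp (-(c * y))) = fun y =>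
      ∑ n ∈ Finset.range (m + 1), (m ! / (n ! * (m - n)!) * B ^ n : ℝ) * (y ^ n * Real.exp (-(c * y))) := by
    funext y
    rw [one_add_mul_pow_eq_sum, Finset.sum_mul]
    exact Finset.sum_congr rfl fun n _ => by ring
  rw [this]
  exact integrable_finsetSum _ fun n _ => (integrableOn_pow_mul_exp_neg_mul n hc).const_mul _

lemma integral_one_add_mul_pow_mul_exp (m : ℕ) (B : ℝ) {c : ℝ} (hc : 0 < c) :
    ∫ y in Ioi (0:ℝ), (1 + B * y) ^ m * Real.exp (-(c * y)) =
      ∑ n ∈ Finset.range (m + 1), (m ! / (m - n)! * B ^ n / c ^ (n + 1) : ℝ) := by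
  have : ∀ y, (1 + B * y) ^ m * Real.exp (-(c * y)) =
      ∑ n ∈ Finset.range (m + 1), (m ! / (n ! * (m - n)!) * B ^ n : ℝ) * (y ^ n * Real.exp (-(c * y))) := by
    intro y
    rw [one_add_mul_pow_eq_sum, Finset.sum_mul]
    exact Finset.sum_congr rfl fun n _ => by ring
  simp_rw [this]
  rw [integral_finsetSum _ fun n _ => (integrableOn_pow_mul_exp_neg_mul n hc).const_mul _]
  refine Finset.sum_congr rfl fun n _ => ?_
  rw [integral_const_mul, integral_pow_mul_exp_neg_mul n hc]
  field_simp

lemma integrable_quadrant_swap {w : ℝ → ℝ} (hw : Measurable w)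
    (hi : IntegrableOn (fun t => w t * Real.exp (-t)) (Ioi 0)) {B : ℝ} (hB : 0 ≤ B) (m : ℕ) :
    Integrable (fun q : ℝ × ℝ => Real.exp (-q.1) *
      (w q.2 * (1 + B * q.1) ^ m * Real.exp (-(q.2 * (1 + B * q.1))))) quadrant := by
  have h := (integrableOn_one_add_mul_pow_mul_exp m B one_pos).mul_prod hi
  refine h.mono (Measurable.aestronglyMeasurable (by fun_prop)) ?_
  filter_upwards [quadrant_pos] with q hq
  obtain ⟨h1, h2⟩ := hq
  have h3 : 0 < 1 + B * q.1 := by positivity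
  simp only [norm_mul, Real.norm_eq_abs, Real.abs_exp, one_mul]
  have h4 : Real.exp (-(q.2 * (1 + B * q.1))) ≤ Real.exp (-q.2) := by
    refine Real.exp_le_exp.2 ?_
    have : 0 ≤ q.2 * (B * q.1) := by positivity
    linarith
  calc _ = |(1 + B * q.1) ^ m| * Real.exp (-q.1) * (|w q.2| * Real.exp (-(q.2 * (1 + B * q.1)))) := by ring
    _ ≤ _ := by gcongr

/-- With the order of integration exchanged, the integral in `y` is that of the polynomial `(1 + B
y)^m` against an exponential of rate `1 + B t`. The binomial theorem then yields the powers `(1 + B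
t)^-(n + 1)` seen in the two-variable G-function and in Tricomi's function. -/
lemma integral_quadrant_swap {w : ℝ → ℝ} (hw : Measurable w)
    (hi : IntegrableOn (fun t => w t * Real.exp (-t)) (Ioi 0)) {B : ℝ} (hB : 0 ≤ B) (m : ℕ) :
    ∫ y in Ioi (0:ℝ), Real.exp (-y) *
      ∫ t in Ioi (0:ℝ), w t * (1 + B * y) ^ m * Real.exp (-(t * (1 + B * y))) =
    ∑ n ∈ Finset.range (m + 1), (m ! / (m - n)! * B ^ n : ℝ) *
      ∫ t in Ioi (0:ℝ), w t * Real.exp (-t) / (1 + B * t) ^ (n + 1) := by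
  have hint := integrable_quadrant_swap hw hi hB m
  simp_rw [← integral_const_mul]
  rw [integral_integral_swap hint]
  have hsum : ∀ t ∈ Ioi (0:ℝ), ∫ y in Ioi (0:ℝ), Real.exp (-y) *
      (w t * (1 + B * y) ^ m * Real.exp (-(t * (1 + B * y)))) =
      ∑ n ∈ Finset.range (m + 1), (m ! / (m - n)! * B ^ n : ℝ) *
        (w t * Real.exp (-t) / (1 + B * t) ^ (n + 1)) := by
    intro t (ht : 0 < t)
    have e : ∀ y, Real.exp (-y) * (w t * (1 + B * y) ^ m * Real.exp (-(t * (1 + B * y)))) =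
        w t * Real.exp (-t) * ((1 + B * y) ^ m * Real.exp (-((1 + B * t) * y))) := fun y => by
      have : Real.exp (-(t * (1 + B * y))) * Real.exp (-y) =
          Real.exp (-t) * Real.exp (-((1 + B * t) * y)) := by
        rw [← Real.exp_add, ← Real.exp_add]; ring_nf
      linear_combination (w t * (1 + B * y) ^ m) * this
    simp_rw [e]
    rw [integral_const_mul, integral_one_add_mul_pow_mul_exp m B (by positivity), Finset.mul_sum]
    exact Finset.sum_congr rfl fun n _ => by ring
  rw [setIntegral_congr_fun measurableSet_Ioi hsum, integral_finsetSum]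
  · intro n _
    refine Integrable.const_mul ?_ _
    refine Integrable.mono hi (Measurable.aestronglyMeasurable
      (f := fun t => w t * Real.exp (-t) / (1 + B * t) ^ (n + 1)) (by fun_prop)) ?_
    filter_upwards [ae_restrict_mem measurableSet_Ioi] with t (ht : 0 < t)
    rw [norm_div, Real.norm_of_nonneg (r := (1 + B * t) ^ (n + 1)) (by positivity)]
    have : 0 ≤ B * t := by positivity
    exact div_le_self (norm_nonneg _) (one_le_pow₀ (by linarith))

/-- This is `integral_quadrant_swap` with weight `t^(m - 1)`. In one order the inner integral equals
`(m - 1)!` for every `y`; in the other each term is a Tricomi function after scaling by `1 / B`. The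
inner sums of `logTerm₁` therefore reduce to the increments `1 / m` of the digamma function. -/
lemma sum_tricomi {B : ℝ} (hB : 0 < B) {m : ℕ} (hm : 1 ≤ m) :
    ∑ n ∈ Finset.range (m + 1), B ^ ((n : ℤ) - (m : ℤ)) / (m - n)! * Real.Gamma m *
      tricomi m ((m : ℝ) - n) (1 / B) = 1 / m := by
  have hm0 : (0:ℝ) < m := by exact_mod_cast hm
  have hw : IntegrableOn (fun t : ℝ => t ^ (m - 1) * Real.exp (-t)) (Ioi 0) :=
    integrableOn_pow_mul_exp_neg _
  have key := integral_quadrant_swap (w := fun t => t ^ (m - 1)) (by fun_prop) hw hB.le m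
  have e1 : ∀ y ∈ Ioi (0:ℝ), Real.exp (-y) *
      ∫ t in Ioi (0:ℝ), t ^ (m - 1) * (1 + B * y) ^ m * Real.exp (-(t * (1 + B * y))) =
      (m - 1)! * (y ^ 0 * Real.exp (-y)) := fun y (hy : 0 < y) => by
    have h1 : 0 < 1 + B * y := by positivity
    have e : ∀ t, t ^ (m - 1) * (1 + B * y) ^ m * Real.exp (-(t * (1 + B * y))) =
        (1 + B * y) ^ m * (t ^ (m - 1) * Real.exp (-((1 + B * y) * t))) := fun t => by
      rw [mul_comm t (1 + B * y)]; ring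
    simp_rw [e]
    rw [integral_const_mul, integral_pow_mul_exp_neg_mul _ h1, Nat.sub_add_cancel hm]
    field_simp
  rw [setIntegral_congr_fun measurableSet_Ioi e1, integral_const_mul, integral_pow_mul_exp_neg] at key
  have e2 : ∀ n ∈ Finset.range (m + 1), B ^ ((n : ℤ) - (m : ℤ)) / (m - n)! * Real.Gamma m *
      tricomi m ((m : ℝ) - n) (1 / B) = 1 / m ! * ((m ! / (m - n)! * B ^ n : ℝ) *
      ∫ t in Ioi (0:ℝ), t ^ (m - 1) * Real.exp (-t) / (1 + B * t) ^ (n + 1)) := fun n hn => by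
    have hs := integral_comp_mul_left_Ioi' (fun t : ℝ => t ^ (m - 1) * Real.exp (-t) / (1 + B * t) ^ (n + 1))
      0 (b := 1 / B) (by positivity)
    rw [mul_zero] at hs
    rw [← hs, tricomi, smul_eq_mul]
    have e3 : ∫ t in Ioi (0:ℝ), Real.exp (-(1 / B) * t) * t ^ ((m : ℝ) - 1) *
        (1 + t) ^ ((m : ℝ) - n - m - 1) = B ^ (m - 1) * ∫ t in Ioi (0:ℝ),
          (1 / B * t) ^ (m - 1) * Real.exp (-(1 / B * t)) / (1 + B * (1 / B * t)) ^ (n + 1) := by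
      rw [← integral_const_mul]
      refine setIntegral_congr_fun measurableSet_Ioi fun t (ht : 0 < t) => ?_
      have h1 : (0:ℝ) < 1 + t := by positivity
      rw [show (m : ℝ) - n - m - 1 = -((n + 1 : ℕ) : ℝ) by push_cast; ring, Real.rpow_neg h1.le,
        Real.rpow_natCast, show (m : ℝ) - 1 = ((m - 1 : ℕ) : ℝ) by rw [Nat.cast_sub hm]; simp,
        Real.rpow_natCast, show B * (1 / B * t) = t by field_simp, neg_mul, mul_pow, one_div, inv_pow]
      field_simp
    rw [e3, zpow_sub₀ hB.ne', zpow_natCast, zpow_natCast]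
    have hG := (Real.Gamma_pos_of_pos hm0).ne'
    have hBm : B ^ m = B * B ^ (m - 1) := by rw [← pow_succ', Nat.sub_add_cancel hm]
    rw [hBm]
    field_simp
  rw [Finset.sum_congr rfl e2, ← Finset.mul_sum, ← key]
  rw [← Nat.mul_factorial_pred (by omega : m ≠ 0)]
  push_cast
  field_simp
  simp

/-- Shifting `t` by one on the left and scaling by `1 / B` on the right turns both sides into the
integral of `e^{-t/B} / (1 + t)` over the half-line. -/
lemma exp_mul_integral_expInt {B : ℝ} (hB : 0 < B) :
    Real.exp (1 / B) * ∫ t in Ioi (1:ℝ), Real.exp (-(1 / B * t)) / t =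
      ∫ y, Real.log (1 + B * y) ∂erlang 0 := by
  rw [integral_log_one_add_mul_erlang 0 hB.le, zero_add, Finset.sum_range_one]
  have h1 := integral_comp_mul_left_Ioi' (fun t : ℝ => B * t ^ 0 * Real.exp (-t) / (1 + B * t))
    0 (b := 1 / B) (by positivity)
  have h2 := (measurePreserving_add_right volume (1:ℝ)).setIntegral_preimage_emb
    (measurableEmbedding_addRight 1) (fun t : ℝ => Real.exp (-(1 / B * t)) / t) (Ioi 1)
  have h3 : (fun x : ℝ => x + 1) ⁻¹' Ioi 1 = Ioi 0 := by ext x; simp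
  rw [h3] at h2
  rw [mul_zero] at h1
  rw [← h1, ← h2, ← integral_const_mul, smul_eq_mul, ← integral_const_mul, ← integral_const_mul]
  refine setIntegral_congr_fun measurableSet_Ioi fun t (ht : 0 < t) => ?_
  rw [show -(1 / B * (t + 1)) = -(1 / B) + -(1 / B * t) by ring, Real.exp_add, Real.exp_neg,
    show B * (1 / B * t) = t by field_simp, pow_zero, Nat.factorial_zero, Nat.cast_one]
  have := (Real.exp_pos (1 / B)).ne'
  field_simp
  ring

/-- For a fixed interference level `y` this is the Erlang formula with `c = A / (1 + B y)`; the
average over `y` is then `integral_quadrant_swap`. -/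
lemma integral_log_firstHop (k : ℕ) {A B : ℝ} (hA : 0 < A) (hB : 0 ≤ B) :
    Integrable (fun q : ℝ × ℝ => Real.log (1 + A * q.1 / (B * q.2 + 1))) ((erlang k).prod (erlang 0)) ∧
    ∫ q : ℝ × ℝ, Real.log (1 + A * q.1 / (B * q.2 + 1)) ∂(erlang k).prod (erlang 0) =
      ∑ m ∈ Finset.range (k + 1), ∑ n ∈ Finset.range (m + 1), (B ^ n / (m - n)! : ℝ) * (A *
        ∫ t in Ioi (0:ℝ), t ^ m * Real.exp (-t) / ((1 + A * t) * (1 + B * t) ^ (n + 1))) := by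
  have hint : Integrable (fun q : ℝ × ℝ => Real.log (1 + A * q.1 / (B * q.2 + 1)))
      ((erlang k).prod (erlang 0)) := by
    have h := ((integrable_id_erlang k).comp_fst (erlang 0)).const_mul A
    refine h.mono' (Measurable.aestronglyMeasurable (by fun_prop)) ?_
    filter_upwards [Measure.quasiMeasurePreserving_fst.ae (erlang_pos k),
      Measure.quasiMeasurePreserving_snd.ae (erlang_pos 0)] with q h1 h2
    have h0 : 0 ≤ A * q.1 / (B * q.2 + 1) := by positivity
    rw [Real.norm_of_nonneg (Real.log_nonneg (by linarith))]
    have := Real.log_le_sub_one_of_pos (x := 1 + A * q.1 / (B * q.2 + 1)) (by linarith)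
    have h3 : A * q.1 / (B * q.2 + 1) ≤ A * q.1 :=
      div_le_self (by positivity) (by have : 0 ≤ B * q.2 := by positivity
                                      linarith)
    linarith
  refine ⟨hint, ?_⟩
  have hw : ∀ m : ℕ, IntegrableOn (fun t : ℝ => A * t ^ m / (1 + A * t) * Real.exp (-t)) (Ioi 0) :=
    fun m => (integrableOn_hop m hA.le).congr (ae_of_all _ fun t => by simp only; ring)
  have inner : ∀ y ∈ Ioi (0:ℝ), (y ^ 0 * Real.exp (-y) / 0 !) •
      ∫ x, Real.log (1 + A * x / (B * y + 1)) ∂erlang k =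
      ∑ m ∈ Finset.range (k + 1), 1 / (m ! : ℝ) * (Real.exp (-y) *
        ∫ t in Ioi (0:ℝ), A * t ^ m / (1 + A * t) * (1 + B * y) ^ m * Real.exp (-(t * (1 + B * y)))) := by
    intro y (hy : 0 < y)
    have h1 : 0 < 1 + B * y := by positivity
    have e : ∀ x, 1 + A * x / (B * y + 1) = 1 + A / (1 + B * y) * x := fun x => by
      rw [add_comm (B * y)]; ring
    simp_rw [e]
    rw [integral_log_one_add_mul_erlang k (by positivity), smul_eq_mul, Finset.mul_sum]
    refine Finset.sum_congr rfl fun m _ => ?_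
    -- The scaling `t ↦ (1 + B y) t` removes `y` from the denominator and leaves it only in the
    -- polynomial and the exponential.
    have hs := integral_comp_mul_left_Ioi' (fun t : ℝ => A / (1 + B * y) * t ^ m * Real.exp (-t) /
      (1 + A / (1 + B * y) * t)) 0 h1
    rw [mul_zero] at hs
    rw [← hs, smul_eq_mul, ← integral_const_mul]
    have : ∫ t in Ioi (0:ℝ), (1 + B * y) * (A / (1 + B * y) * ((1 + B * y) * t) ^ m *
        Real.exp (-((1 + B * y) * t)) / (1 + A / (1 + B * y) * ((1 + B * y) * t))) =
        ∫ t in Ioi (0:ℝ), A * t ^ m / (1 + A * t) * (1 + B * y) ^ m * Real.exp (-(t * (1 + B * y))) := by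
      refine setIntegral_congr_fun measurableSet_Ioi fun t (ht : 0 < t) => ?_
      rw [show A / (1 + B * y) * ((1 + B * y) * t) = A * t by field_simp, mul_comm t (1 + B * y), mul_pow]
      field_simp
    rw [this]
    simp; ring
  rw [integral_prod_symm _ hint, integral_erlang 0, setIntegral_congr_fun measurableSet_Ioi inner,
    integral_finsetSum]
  · refine Finset.sum_congr rfl fun m _ => ?_
    rw [integral_const_mul, integral_quadrant_swap (w := fun t => A * t ^ m / (1 + A * t))
      (by fun_prop) (hw m) hB m, Finset.mul_sum]
    refine Finset.sum_congr rfl fun n _ => ?_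
    have : ∫ t in Ioi (0:ℝ), A * t ^ m / (1 + A * t) * Real.exp (-t) / (1 + B * t) ^ (n + 1) =
        A * ∫ t in Ioi (0:ℝ), t ^ m * Real.exp (-t) / ((1 + A * t) * (1 + B * t) ^ (n + 1)) := by
      rw [← integral_const_mul]
      refine setIntegral_congr_fun measurableSet_Ioi fun t (ht : 0 < t) => ?_
      field_simp
    rw [this]
    have := Nat.factorial_ne_zero m
    have : (m ! : ℝ) ≠ 0 := by exact_mod_cast this
    rw [show ∀ I : ℝ, 1 / (m ! : ℝ) * (m ! / (m - n)! * B ^ n * I) = B ^ n / (m - n)! * I from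
      fun I => by field_simp]
  · intro m _
    have := (integrable_quadrant_swap (w := fun t => A * t ^ m / (1 + A * t))
      (by fun_prop) (hw m) hB m).integral_prod_left
    simp only [integral_const_mul] at this
    exact this.const_mul _

/-- Given `v`, the Erlang formula has the factor `c v / (1 + c v u) = v / (c⁻¹ + u v)`, which raises
the power of `v` to `j + 1`. The outcome is the quadrant integral of `meijerG_hop` with `z = c⁻¹`
and `r = j + 1`. -/
lemma integral_log_secondHop (k j : ℕ) {c : ℝ} (hc : 0 < c) :
    Integrable (fun q : ℝ × ℝ => Real.log (1 + c * q.1 * q.2)) ((erlang j).prod (erlang k)) ∧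
    ∫ q : ℝ × ℝ, Real.log (1 + c * q.1 * q.2) ∂(erlang j).prod (erlang k) =
      ∑ m ∈ Finset.range (k + 1), 1 / (m ! * j ! : ℝ) * ∫ q : ℝ × ℝ, q.1 ^ m * Real.exp (-q.1) *
        (q.2 ^ (j + 1) * Real.exp (-q.2)) / (c⁻¹ + q.1 * q.2) ∂quadrant := by
  have hint : Integrable (fun q : ℝ × ℝ => Real.log (1 + c * q.1 * q.2))
      ((erlang j).prod (erlang k)) := by
    have h := ((integrable_id_erlang j).const_mul c).mul_prod (integrable_id_erlang k)
    refine h.mono' (Measurable.aestronglyMeasurable (by fun_prop)) ?_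
    filter_upwards [Measure.quasiMeasurePreserving_fst.ae (erlang_pos j),
      Measure.quasiMeasurePreserving_snd.ae (erlang_pos k)] with q h1 h2
    have h0 : 0 ≤ c * q.1 * q.2 := by positivity
    rw [Real.norm_of_nonneg (Real.log_nonneg (by linarith))]
    have := Real.log_le_sub_one_of_pos (x := 1 + c * q.1 * q.2) (by linarith)
    linarith
  refine ⟨hint, ?_⟩
  have hq : ∀ m : ℕ, Integrable (fun q : ℝ × ℝ => q.1 ^ m * Real.exp (-q.1) *
      (q.2 ^ (j + 1) * Real.exp (-q.2)) / (c⁻¹ + q.1 * q.2)) quadrant := fun m => by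
    have h := ((integrableOn_pow_mul_exp_neg m).mul_prod (integrableOn_pow_mul_exp_neg (j + 1))).const_mul c
    refine h.mono' (Measurable.aestronglyMeasurable (by fun_prop)) ?_
    filter_upwards [quadrant_pos] with q hq
    obtain ⟨h1, h2⟩ := hq
    rw [Real.norm_of_nonneg (by positivity), div_le_iff₀ (by positivity)]
    have h3 : 1 ≤ c * (c⁻¹ + q.1 * q.2) := by
      rw [mul_add, mul_inv_cancel₀ hc.ne']
      have : 0 ≤ c * (q.1 * q.2) := by positivity
      linarith
    have h4 : 0 ≤ q.1 ^ m * Real.exp (-q.1) * (q.2 ^ (j + 1) * Real.exp (-q.2)) := by positivity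
    nlinarith
  have inner : ∀ v ∈ Ioi (0:ℝ), (v ^ j * Real.exp (-v) / j !) •
      ∫ u, Real.log (1 + c * v * u) ∂erlang k =
      ∑ m ∈ Finset.range (k + 1), 1 / (m ! * j ! : ℝ) *
        ∫ u in Ioi (0:ℝ), u ^ m * Real.exp (-u) * (v ^ (j + 1) * Real.exp (-v)) / (c⁻¹ + u * v) := by
    intro v (hv : 0 < v)
    rw [integral_log_one_add_mul_erlang k (by positivity), smul_eq_mul, Finset.mul_sum]
    refine Finset.sum_congr rfl fun m _ => ?_
    rw [← mul_assoc, ← integral_const_mul, ← integral_const_mul]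
    refine setIntegral_congr_fun measurableSet_Ioi fun u (hu : 0 < u) => ?_
    have : c⁻¹ + u * v = (1 + c * v * u) / c := by field_simp
    rw [this]
    field_simp
    ring
  rw [integral_prod _ hint, integral_erlang j, setIntegral_congr_fun measurableSet_Ioi inner,
    integral_finsetSum]
  · refine Finset.sum_congr rfl fun m _ => ?_
    rw [integral_const_mul, ← integral_prod_symm _ (hq m)]
  · intro m _
    exact ((hq m).integral_prod_right).const_mul _

end EHRelay

/-! ### Laws of the channel gains, by characteristic functions -/

namespace EHRelay
open Set Filter Topology Complex

lemma integrableOn_pow_mul_cexp (k : ℕ) {b : ℂ} (hb : 0 < b.re) :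
    IntegrableOn (fun x : ℝ => (x : ℂ) ^ k * cexp (-b * x)) (Ioi 0) := by
  refine (integrableOn_pow_mul_exp_neg_mul k hb).mono' (Measurable.aestronglyMeasurable (by fun_prop)) ?_
  filter_upwards [ae_restrict_mem measurableSet_Ioi] with x (hx : 0 < x)
  rw [norm_mul, norm_pow, Complex.norm_real, Real.norm_of_nonneg hx.le, Complex.norm_exp]
  simp

lemma integral_pow_mul_cexp (k : ℕ) {b : ℂ} (hb : 0 < b.re) :
    ∫ x in Ioi (0:ℝ), (x : ℂ) ^ k * cexp (-b * x) = k ! / b ^ (k + 1) := by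
  have hb0 : b ≠ 0 := fun h => by simp [h] at hb
  induction k with
  | zero =>
    simp only [pow_zero, one_mul]
    rw [integral_exp_mul_complex_Ioi (by simpa using hb)]
    simp
  | succ k ih =>
    have hd : ∀ x ∈ Ici (0:ℝ), HasDerivAt (fun x : ℝ => (x : ℂ) ^ (k + 1) * cexp (-b * x))
        (((k + 1 : ℕ) : ℂ) * ((x : ℂ) ^ k * cexp (-b * x)) - b * ((x : ℂ) ^ (k + 1) * cexp (-b * x))) x := by
      intro x _
      have h1 : HasDerivAt (fun x : ℂ => x ^ (k + 1) * cexp (-b * x))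
          (((k + 1 : ℕ) : ℂ) * ((x : ℂ) ^ k * cexp (-b * x)) - b * ((x : ℂ) ^ (k + 1) * cexp (-b * x))) x := by
        have := (hasDerivAt_pow (k + 1) (x : ℂ)).mul (((hasDerivAt_id (x : ℂ)).const_mul (-b)).cexp)
        refine this.congr_deriv ?_
        simp; ring
      exact h1.comp_ofReal
    have hl : Tendsto (fun x : ℝ => (x : ℂ) ^ (k + 1) * cexp (-b * x)) atTop (𝓝 0) := by
      rw [tendsto_zero_iff_norm_tendsto_zero]
      have := tendsto_rpow_mul_exp_neg_mul_atTop_nhds_zero ((k + 1 : ℕ) : ℝ) b.re hb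
      refine this.congr' ?_
      filter_upwards [eventually_ge_atTop 0] with x hx
      rw [norm_mul, norm_pow, Complex.norm_real, Real.norm_of_nonneg hx, Complex.norm_exp,
        Real.rpow_natCast]
      simp
    have hi := ((integrableOn_pow_mul_cexp k hb).const_mul ((k + 1 : ℕ) : ℂ)).sub
      ((integrableOn_pow_mul_cexp (k + 1) hb).const_mul b)
    have := integral_Ioi_of_hasDerivAt_of_tendsto' hd hi hl
    rw [integral_sub ((integrableOn_pow_mul_cexp k hb).const_mul _)
      ((integrableOn_pow_mul_cexp (k + 1) hb).const_mul b), integral_const_mul, integral_const_mul, ih] at this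
    simp only [ofReal_zero, ne_eq, Nat.add_eq_zero_iff, one_ne_zero, and_false, not_false_eq_true,
      zero_pow, zero_mul, sub_zero] at this
    rw [← mul_right_inj' hb0, ← sub_eq_zero.1 this, Nat.factorial_succ]
    push_cast
    field_simp
    ring

lemma charFun_erlang (k : ℕ) (t : ℝ) : charFun (erlang k) t = ((1 - t * I) ^ (k + 1))⁻¹ := by
  rw [charFun_apply_real, integral_erlang]
  have h := integral_pow_mul_cexp k (b := 1 - t * I) (by simp)
  have hk : (k ! : ℂ) ≠ 0 := by exact_mod_cast Nat.factorial_ne_zero k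
  calc _ = ∫ x in Ioi (0:ℝ), (k ! : ℂ)⁻¹ * ((x : ℂ) ^ k * cexp (-(1 - t * I) * x)) := by
        refine setIntegral_congr_fun measurableSet_Ioi fun x _ => ?_
        rw [show -(1 - t * I) * x = -(x : ℂ) + t * x * I by ring, Complex.exp_add, Complex.real_smul]
        push_cast
        ring
    _ = _ := by
      rw [integral_const_mul, h]
      field_simp

instance : IsProbabilityMeasure stdComplexGaussian :=
  Measure.isProbabilityMeasure_map (by
    refine Measurable.aemeasurable ?_
    exact Complex.measurableEquivRealProd.symm.measurable)

lemma integral_stdComplexGaussian (f : ℂ → ℂ) :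
    ∫ z, f z ∂stdComplexGaussian = ∫ x : ℝ × ℝ, f (⟨x.1, x.2⟩ : ℂ)
      ∂(gaussianReal 0 (1 / 2)).prod (gaussianReal 0 (1 / 2)) := by
  rw [stdComplexGaussian]
  exact integral_map_equiv Complex.measurableEquivRealProd.symm f

lemma charFun_stdComplexGaussian (t : ℂ) :
    charFun stdComplexGaussian t = cexp (-(‖t‖ ^ 2 / 4 : ℝ)) := by
  rw [charFun_apply, integral_stdComplexGaussian]
  have e : ∀ x : ℝ × ℝ, cexp (inner ℝ (⟨x.1, x.2⟩ : ℂ) t * I) =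
      cexp (t.re * x.1 * I) * cexp (t.im * x.2 * I) := fun x => by
    rw [← Complex.exp_add, Complex.inner]
    congr 1
    simp
    ring
  simp_rw [e]
  rw [integral_prod_mul (fun x : ℝ => cexp (t.re * x * I)) (fun x : ℝ => cexp (t.im * x * I)),
    ← charFun_apply_real, ← charFun_apply_real, charFun_gaussianReal, charFun_gaussianReal,
    ← Complex.exp_add, ← Complex.normSq_eq_norm_sq, Complex.normSq_apply]
  congr 1
  push_cast
  simp
  ring

/-- Stated for the square because a `CN(0,1)` variable has two such real components; this also
removes the branch of the complex square root. -/
lemma integral_cexp_sq_gaussianReal (t : ℝ) :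
    (∫ x : ℝ, cexp (t * (x : ℂ) ^ 2 * I) ∂gaussianReal 0 (1 / 2)) ^ 2 = (1 - t * I)⁻¹ := by
  have hb : (0:ℝ) < (1 - t * I : ℂ).re := by simp
  have hb0 : (1 - t * I : ℂ) ≠ 0 := fun h => by rw [h] at hb; simp at hb
  rw [integral_gaussianReal_eq_integral_smul (by norm_num)]
  have e : ∀ x : ℝ, gaussianPDFReal 0 (1 / 2) x • cexp (t * (x : ℂ) ^ 2 * I) =
      ((√Real.pi)⁻¹ : ℝ) * cexp (-(1 - t * I) * (x : ℂ) ^ 2) := fun x => by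
    rw [gaussianPDFReal, Complex.real_smul, show -(1 - t * I) * (x : ℂ) ^ 2 =
      ((-x ^ 2 : ℝ) : ℂ) + t * (x : ℂ) ^ 2 * I by push_cast; ring, Complex.exp_add, ← ofReal_exp]
    rw [ofReal_mul, mul_assoc]
    have : ((1 / 2 : ℝ≥0) : ℝ) = 1 / 2 := by push_cast; rfl
    rw [this]
    ring_nf
  simp_rw [e]
  rw [integral_const_mul, integral_gaussian_complex hb, mul_pow, ← Complex.cpow_nat_mul, ← ofReal_pow,
    inv_pow, Real.sq_sqrt Real.pi_pos.le]
  have : (Real.pi : ℂ) ≠ 0 := ofReal_ne_zero.2 Real.pi_ne_zero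
  norm_num
  field_simp

lemma integral_cexp_normSq_stdComplexGaussian (t : ℝ) :
    ∫ z, cexp (t * ((‖z‖ ^ 2 : ℝ) : ℂ) * I) ∂stdComplexGaussian = (1 - t * I)⁻¹ := by
  rw [integral_stdComplexGaussian, ← integral_cexp_sq_gaussianReal, sq,
    ← integral_prod_mul (fun x : ℝ => cexp (t * (x : ℂ) ^ 2 * I)) (fun x : ℝ => cexp (t * (x : ℂ) ^ 2 * I))]
  refine integral_congr_ae (ae_of_all _ fun x => ?_)
  simp only
  rw [← Complex.exp_add, ← Complex.normSq_eq_norm_sq, Complex.normSq_mk]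
  congr 1
  push_cast
  ring

lemma map_normSq_stdComplexGaussian : stdComplexGaussian.map (fun z => ‖z‖ ^ 2) = erlang 0 := by
  have hm : Measurable fun z : ℂ => ‖z‖ ^ 2 := by fun_prop
  have := Measure.isProbabilityMeasure_map (μ := stdComplexGaussian) hm.aemeasurable
  refine Measure.ext_of_charFun (funext fun t => ?_)
  rw [charFun_erlang, charFun_apply_real, integral_map hm.aemeasurable
    (Measurable.aestronglyMeasurable (by fun_prop)), integral_cexp_normSq_stdComplexGaussian]
  simp

/-- The law of a vector of `n` independent `CN(0,1)` entries. -/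
noncomputable def stdVec (n : ℕ) : Measure (Fin n → ℂ) := Measure.pi fun _ => stdComplexGaussian

instance (n : ℕ) : IsProbabilityMeasure (stdVec n) := by unfold stdVec; infer_instance

instance (n : ℕ) : SigmaFinite (stdVec n) := IsFiniteMeasure.toSigmaFinite _

instance (n : ℕ) : SFinite (stdVec n) := instSFiniteOfSigmaFinite

lemma map_sum_normSq_stdVec (k : ℕ) :
    (stdVec (k + 1)).map (fun h => ∑ i, ‖h i‖ ^ 2) = erlang k := by
  have hm : Measurable fun h : Fin (k + 1) → ℂ => ∑ i, ‖h i‖ ^ 2 := by fun_prop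
  have := Measure.isProbabilityMeasure_map (μ := stdVec (k + 1)) hm.aemeasurable
  refine Measure.ext_of_charFun (funext fun t => ?_)
  rw [charFun_erlang, charFun_apply_real, integral_map hm.aemeasurable
    (Measurable.aestronglyMeasurable (by fun_prop))]
  have e : ∀ h : Fin (k + 1) → ℂ, cexp (t * ((∑ i, ‖h i‖ ^ 2 : ℝ) : ℂ) * I) =
      ∏ i, cexp (t * ((‖h i‖ ^ 2 : ℝ) : ℂ) * I) := fun h => by
    rw [← Complex.exp_sum, ofReal_sum, Finset.mul_sum, Finset.sum_mul]
  simp_rw [e]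
  rw [stdVec, integral_fintype_prod_eq_prod (fun _ z => cexp (t * ((‖z‖ ^ 2 : ℝ) : ℂ) * I))]
  simp only [integral_cexp_normSq_stdComplexGaussian, Finset.prod_const, Finset.card_univ, Fintype.card_fin, inv_pow]

/-- Rotation invariance: the characteristic function of an entry depends only on `‖t‖²`, so the
factors for `e i * t` multiply to the one for `t` when `e` is a unit vector. -/
lemma map_sum_conj_mul_stdVec {n : ℕ} {e : Fin n → ℂ} (he : ∑ i, ‖e i‖ ^ 2 = 1) :
    (stdVec n).map (fun h => ∑ i, starRingEnd ℂ (e i) * h i) = stdComplexGaussian := by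
  have hm : Measurable fun h : Fin n → ℂ => ∑ i, starRingEnd ℂ (e i) * h i := by fun_prop
  have := Measure.isProbabilityMeasure_map (μ := stdVec n) hm.aemeasurable
  refine Measure.ext_of_charFun (funext fun t => ?_)
  rw [charFun_stdComplexGaussian, charFun_apply, integral_map hm.aemeasurable
    (Measurable.aestronglyMeasurable (by fun_prop))]
  have e1 : ∀ h : Fin n → ℂ, cexp (inner ℝ (∑ i, starRingEnd ℂ (e i) * h i) t * I) =
      ∏ i, cexp (inner ℝ (h i) (e i * t) * I) := fun h => by
    rw [← Complex.exp_sum, sum_inner, ofReal_sum, Finset.sum_mul]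
    congr 1
    refine Finset.sum_congr rfl fun i _ => ?_
    rw [Complex.inner, Complex.inner]
    congr 3
    simp only [map_mul, conj_conj]
    ring
  simp_rw [e1]
  rw [stdVec, integral_fintype_prod_eq_prod (fun i z => cexp (inner ℝ z (e i * t) * I))]
  simp_rw [← charFun_apply, charFun_stdComplexGaussian]
  rw [← Complex.exp_sum]
  congr 1
  rw [Finset.sum_neg_distrib, ← ofReal_sum]
  congr 2
  rw [← one_mul (‖t‖ ^ 2), ← he, Finset.sum_mul, Finset.sum_div]
  exact Finset.sum_congr rfl fun i _ => by rw [norm_mul, mul_pow]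

lemma map_normSq_inner_stdVec {n : ℕ} {a : Fin n → ℂ} (ha : 0 < ∑ i, ‖a i‖ ^ 2) :
    (stdVec n).map (fun h => ‖∑ i, starRingEnd ℂ (a i) * h i‖ ^ 2 / ∑ i, ‖a i‖ ^ 2) = erlang 0 := by
  set S := ∑ i, ‖a i‖ ^ 2 with hS
  have he : ∑ i, ‖a i / (√S : ℂ)‖ ^ 2 = 1 := by
    simp_rw [norm_div, Complex.norm_real, Real.norm_of_nonneg (Real.sqrt_nonneg S), div_pow,
      Real.sq_sqrt ha.le]
    rw [← Finset.sum_div, ← hS, div_self ha.ne']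
  rw [← map_normSq_stdComplexGaussian, ← map_sum_conj_mul_stdVec he, Measure.map_map (by fun_prop) (by fun_prop)]
  congr 1
  funext h
  simp only [Function.comp]
  have : ∀ i, starRingEnd ℂ (a i / (√S : ℂ)) * h i = starRingEnd ℂ (a i) * h i / (√S : ℂ) := fun i => by
    rw [map_div₀, conj_ofReal]; ring
  simp_rw [this]
  rw [← Finset.sum_div, norm_div, Complex.norm_real, Real.norm_of_nonneg (Real.sqrt_nonneg S), div_pow,
    Real.sq_sqrt ha.le]

/-- The conditional law of the projected interference is the same exponential law for every nonzero
`h₁`, so the joint law is a product although both coordinates are built from `h₁`. The zero vector,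
where the quotient degenerates, is null. -/
lemma measurePreserving_firstHop (k : ℕ) :
    MeasurePreserving (fun p : (Fin (k + 1) → ℂ) × (Fin (k + 1) → ℂ) =>
      (∑ i, ‖p.1 i‖ ^ 2, ‖∑ i, starRingEnd ℂ (p.1 i) * p.2 i‖ ^ 2 / ∑ i, ‖p.1 i‖ ^ 2))
      ((stdVec (k + 1)).prod (stdVec (k + 1))) ((erlang k).prod (erlang 0)) := by
  have hf : MeasurePreserving (fun h : Fin (k + 1) → ℂ => ∑ i, ‖h i‖ ^ 2) (stdVec (k + 1)) (erlang k) :=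
    ⟨by fun_prop, map_sum_normSq_stdVec k⟩
  refine hf.skew_product (g := fun (a h : Fin (k + 1) → ℂ) => ‖∑ i, starRingEnd ℂ (a i) * h i‖ ^ 2 / ∑ i, ‖a i‖ ^ 2)
    (by unfold Function.uncurry; fun_prop) ?_
  filter_upwards [hf.quasiMeasurePreserving.ae (erlang_pos k)] with a ha
  exact map_normSq_inner_stdVec ha

lemma measurePreserving_secondHop (k : ℕ) :
    MeasurePreserving (fun p : ((Fin (k + 1) → ℂ) × (Fin (k + 1) → ℂ)) × (Fin (k + 1) → ℂ) =>
      ((∑ i, ‖p.1.1 i‖ ^ 2, ∑ i, ‖p.1.2 i‖ ^ 2), ∑ i, ‖p.2 i‖ ^ 2))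
      (((stdVec (k + 1)).prod (stdVec (k + 1))).prod (stdVec (k + 1)))
      (((erlang k).prod (erlang k)).prod (erlang k)) := by
  have hf : MeasurePreserving (fun h : Fin (k + 1) → ℂ => ∑ i, ‖h i‖ ^ 2) (stdVec (k + 1)) (erlang k) :=
    ⟨by fun_prop, map_sum_normSq_stdVec k⟩
  exact (hf.prod hf).prod hf

lemma RayleighFading.aemeasurable {Ω : Type*} [MeasurableSpace Ω] {P : Measure Ω} {N : ℕ}
    {h₁ hI h₂ : Ω → EuclideanSpace ℂ (Fin N)} (h : RayleighFading P h₁ hI h₂) (k : Fin 3) :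
    AEMeasurable (fun ω => (![h₁ ω, hI ω, h₂ ω] k).ofLp) P :=
  aemeasurable_pi_lambda _ fun i => (h.law k i).aemeasurable

/-- Independence over the index set `Fin 3 × Fin N` is curried into independence of the three
vectors, and the product over `Fin 3` is then regrouped as nested pairs. -/
lemma RayleighFading.map_eq {Ω : Type*} [MeasurableSpace Ω] {P : Measure Ω} [IsProbabilityMeasure P]
    {N : ℕ} {h₁ hI h₂ : Ω → EuclideanSpace ℂ (Fin N)} (h : RayleighFading P h₁ hI h₂) :
    P.map (fun ω => (((h₁ ω).ofLp, (hI ω).ofLp), (h₂ ω).ofLp)) =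
      ((stdVec N).prod (stdVec N)).prod (stdVec N) := by
  have hq : ∀ q : Fin 3 × Fin N, AEMeasurable (fun ω => (![h₁ ω, hI ω, h₂ ω] q.1).ofLp q.2) P :=
    fun q => (h.law q.1 q.2).aemeasurable
  have h1 := (iIndepFun_iff_map_fun_eq_pi_map hq).1 h.indep
  simp_rw [(h.law _ _).map_eq] at h1
  have h2 : P.map (fun ω k => (![h₁ ω, hI ω, h₂ ω] k).ofLp) = Measure.pi fun _ => stdVec N := by
    have e := Measure.infinitePi_map_curry (fun (_ : Fin 3) (_ : Fin N) => stdComplexGaussian)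
    simp only [Measure.infinitePi_eq_pi] at e
    rw [← h1, AEMeasurable.map_map_of_aemeasurable (MeasurableEquiv.measurable _).aemeasurable
      (aemeasurable_pi_lambda _ hq)] at e
    exact e
  have hc : ((stdVec N).prod (stdVec N)).prod (stdVec N) = (Measure.pi fun _ : Fin 3 => stdVec N).map
      fun w => ((w 0, w 1), w 2) := by
    have hI : iIndepFun (fun (k : Fin 3) (w : Fin 3 → Fin N → ℂ) => w k)
        (Measure.pi fun _ : Fin 3 => stdVec N) :=
      iIndepFun_pi (X := fun _ => id) fun _ => aemeasurable_id
    have i1 := hI.indepFun_prodMk (fun i => measurable_pi_apply i) 0 1 2 (by decide) (by decide)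
    have i2 := hI.indepFun (show (0 : Fin 3) ≠ 1 by decide)
    have mi : ∀ i : Fin 3, Measurable fun w : Fin 3 → Fin N → ℂ => w i := measurable_pi_apply
    rw [indepFun_iff_map_prod_eq_prod_map_map ((mi 0).prodMk (mi 1)).aemeasurable (mi 2).aemeasurable] at i1
    rw [indepFun_iff_map_prod_eq_prod_map_map (mi 0).aemeasurable (mi 1).aemeasurable] at i2
    have m : ∀ i : Fin 3, (Measure.pi fun _ : Fin 3 => stdVec N).map (fun w => w i) = stdVec N :=
      fun i => (measurePreserving_eval (fun _ : Fin 3 => stdVec N) i).map_eq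
    rw [i1, i2, m, m, m]
  rw [hc, ← h2, AEMeasurable.map_map_of_aemeasurable (Measurable.aemeasurable (by fun_prop))
    (aemeasurable_pi_lambda _ h.aemeasurable)]
  rfl

end EHRelay

/-! ### Signed mixtures and the sum of two scaled Erlang variables -/

namespace EHRelay
open Set Filter Topology Complex

/-- A probability law whose characteristic function is a linear combination, with coefficients of
any sign, of characteristic functions of probability laws integrates as that combination. -/
lemma integral_of_charFun_eq_sum {ι : Type*} {μ : Measure ℝ} [IsProbabilityMeasure μ] (S : Finset ι)
    (ν : ι → Measure ℝ) [∀ i, IsProbabilityMeasure (ν i)] (w : ι → ℝ)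
    (h : ∀ t, charFun μ t = ∑ i ∈ S, (w i : ℂ) * charFun (ν i) t)
    {f : ℝ → ℝ} (hf : ∀ i ∈ S, Integrable f (ν i)) :
    Integrable f μ ∧ ∫ x, f x ∂μ = ∑ i ∈ S, w i * ∫ x, f x ∂ν i := by
  -- Negative weights are moved to the other side: `μ + M' = M` is an equality of finite positive
  -- measures, to which uniqueness of characteristic functions applies. It also gives `μ ≤ M`,
  -- whence integrability.
  set M : Measure ℝ := ∑ i ∈ S, (w i).toNNReal • ν i with hM
  set M' : Measure ℝ := ∑ i ∈ S, (-w i).toNNReal • ν i with hM'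
  have hw : ∀ i, ((w i).toNNReal : ℝ) - ((-w i).toNNReal : ℝ) = w i := fun i => by
    rw [Real.coe_toNNReal', Real.coe_toNNReal']
    exact max_zero_sub_eq_self (w i)
  have hcomb : ∀ {E : Type} [NormedAddCommGroup E] [NormedSpace ℝ E] (u : ι → ℝ≥0) (g : ℝ → E),
      (∀ i ∈ S, Integrable g (ν i)) → ∫ x, g x ∂(∑ i ∈ S, u i • ν i) = ∑ i ∈ S, (u i : ℝ) • ∫ x, g x ∂ν i := by
    intro E _ _ u g hg
    rw [integral_finsetSum_measure fun i hi => (hg i hi).smul_measure_nnreal]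
    exact Finset.sum_congr rfl fun i _ => integral_smul_nnreal_measure _ _
  have hexp : ∀ (t : ℝ) (ρ : Measure ℝ) [IsFiniteMeasure ρ], Integrable (fun x : ℝ => cexp (t * x * I)) ρ :=
    fun t ρ _ => by
      refine (integrable_const (1:ℝ)).mono' (Measurable.aestronglyMeasurable (by fun_prop)) (ae_of_all _ fun x => ?_)
      rw [← ofReal_mul, Complex.norm_exp_ofReal_mul_I]
  have hEq : μ + M' = M := by
    refine Measure.ext_of_charFun (funext fun t => ?_)
    rw [charFun_apply_real, charFun_apply_real, integral_add_measure (hexp t _) (hexp t _),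
      hcomb _ _ fun i _ => hexp t _, hcomb _ _ fun i _ => hexp t _, ← charFun_apply_real, h,
      ← Finset.sum_add_distrib]
    refine Finset.sum_congr rfl fun i _ => ?_
    have hwi : (w i : ℂ) = ((w i).toNNReal : ℝ) - ((-w i).toNNReal : ℝ) := by
      rw [← ofReal_sub, hw]
    rw [← charFun_apply_real, hwi, Complex.real_smul, Complex.real_smul]
    ring
  have hfM : ∀ u : ι → ℝ≥0, Integrable f (∑ i ∈ S, u i • ν i) := fun u =>
    integrable_finsetSum_measure.2 fun i hi => (hf i hi).smul_measure_nnreal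
  have hfμ : Integrable f μ := (hfM _).mono_measure (by rw [← hM, ← hEq]; exact Measure.le_add_right le_rfl)
  refine ⟨hfμ, ?_⟩
  have e := integral_add_measure hfμ (hfM fun i => (-w i).toNNReal)
  rw [← hM', hEq, hM, hM', hcomb _ _ hf, hcomb _ _ hf] at e
  rw [← sub_eq_iff_eq_add] at e
  rw [← e, ← Finset.sum_sub_distrib]
  refine Finset.sum_congr rfl fun i _ => ?_
  rw [← sub_smul, hw, smul_eq_mul]

/-- Pascal's rule makes the product with `1 - y` telescope, lowering `k + 1` to `k`. -/
lemma one_sub_mul_sum_choose {R : Type*} [CommRing R] (k n : ℕ) (y : R) :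
    (1 - y) * ∑ j ∈ Finset.range (n + 1), ((k + 1 + j).choose j : R) * y ^ j =
      ∑ j ∈ Finset.range (n + 1), ((k + j).choose j : R) * y ^ j - ((k + 1 + n).choose n : R) * y ^ (n + 1) := by
  induction n with
  | zero => simp
  | succ n ih =>
    rw [Finset.sum_range_succ, mul_add, ih, Finset.sum_range_succ _ (n + 1)]
    have : (k + 1 + (n + 1)).choose (n + 1) = (k + 1 + n).choose n + (k + (n + 1)).choose (n + 1) := by
      rw [show k + 1 + (n + 1) = (k + 1 + n) + 1 by ring, Nat.choose_succ_succ,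
        show k + (n + 1) = k + 1 + n by ring]
    rw [this]
    push_cast
    ring

/-- The Chaundy–Bullard identity. -/
lemma sum_choose_mul_pow_eq_one {R : Type*} [CommRing R] (k : ℕ) {x y : R} (h : x + y = 1) :
    ∑ j ∈ Finset.range (k + 1), ((k + j).choose j : R) * (x ^ (k + 1) * y ^ j) +
      ∑ j ∈ Finset.range (k + 1), ((k + j).choose j : R) * (y ^ (k + 1) * x ^ j) = 1 := by
  have half : ∀ (k : ℕ) (x y : R), ∑ j ∈ Finset.range (k + 1), ((k + j).choose j : R) * (x ^ (k + 1) * y ^ j) =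
      x ^ (k + 1) * ∑ j ∈ Finset.range (k + 1), ((k + j).choose j : R) * y ^ j := fun k x y => by
    rw [Finset.mul_sum]
    exact Finset.sum_congr rfl fun j _ => by ring
  -- Passing from `k` to `k + 1` changes each half by a term proportional to `1 - 2y = x - y`. This
  -- is antisymmetric in `x` and `y`, so the two changes cancel.
  have step : ∀ (k : ℕ) (x y : R), x + y = 1 →
      x ^ (k + 1 + 1) * ∑ j ∈ Finset.range (k + 1 + 1), ((k + 1 + j).choose j : R) * y ^ j =
      x ^ (k + 1) * ∑ j ∈ Finset.range (k + 1), ((k + j).choose j : R) * y ^ j +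
        ((2 * k + 1).choose (k + 1) : R) * (x ^ (k + 1) * y ^ (k + 1)) * (1 - 2 * y) := by
    intro k x y h
    have h1 := one_sub_mul_sum_choose k (k + 1) y
    rw [Finset.sum_range_succ _ (k + 1), Finset.sum_range_succ (fun j => ((k + j).choose j : R) * y ^ j)] at h1
    have h2 : (k + 1 + (k + 1)).choose (k + 1) = 2 * (2 * k + 1).choose (k + 1) := by
      rw [show k + 1 + (k + 1) = (2 * k + 1) + 1 by ring, Nat.choose_succ_succ, Nat.choose_symm_half]
      ring
    rw [h2, show k + (k + 1) = 2 * k + 1 by ring] at h1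
    have hx : x = 1 - y := by rw [← h]; ring
    rw [pow_succ x (k + 1), mul_assoc]
    nth_rw 2 [hx]
    rw [Finset.sum_range_succ _ (k + 1), h2, h1]
    push_cast
    ring
  induction k with
  | zero => simpa using h
  | succ k ih =>
    rw [half, half, step k x y h, step k y x (by rw [add_comm, h])]
    rw [half, half] at ih
    linear_combination ih - 2 * ((2 * k + 1).choose (k + 1) : R) * (x ^ (k + 1) * y ^ (k + 1)) * h

/-- The weights of the decomposition of `a X + b Z`, with `X`, `Z` independent Erlang variables of
shape `k + 1`, into Erlang laws of scale `a`. -/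
noncomputable def erlangWeight (a b : ℝ) (k j : ℕ) : ℝ :=
  (k + j).choose j * ((a / (a - b)) ^ (k + 1) * (b / (b - a)) ^ j)

/-- Partial fractions in closed form. The numbers `a q / (a - b)` and `b p / (b - a)` add up to one;
multiplying the left side by the Chaundy–Bullard identity for them cancels all powers of `q` in the
first sum and all powers of `p` in the second. -/
lemma inv_pow_mul_inv_pow_eq_sum {a b : ℝ} (hab : a ≠ b) (k : ℕ) {p q : ℂ} (hp : p ≠ 0) (hq : q ≠ 0)
    (h : b * p - a * q = b - a) :
    (p ^ (k + 1))⁻¹ * (q ^ (k + 1))⁻¹ =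
      ∑ j ∈ Finset.range (k + 1), (erlangWeight a b k j : ℂ) * (p ^ (k - j + 1))⁻¹ +
      ∑ j ∈ Finset.range (k + 1), (erlangWeight b a k j : ℂ) * (q ^ (k - j + 1))⁻¹ := by
  have h1 : (b : ℂ) - a ≠ 0 := by rw [sub_ne_zero]; exact_mod_cast hab.symm
  have h2 : (a : ℂ) - b ≠ 0 := by rw [sub_ne_zero]; exact_mod_cast hab
  have hxy : a * q / (a - b) + b * p / (b - a) = (1 : ℂ) := by
    rw [← neg_sub (b : ℂ) a, div_neg, neg_add_eq_sub, ← sub_div, div_eq_one_iff_eq h1, h]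
  have key := sum_choose_mul_pow_eq_one k hxy
  rw [← mul_one ((p ^ (k + 1))⁻¹ * (q ^ (k + 1))⁻¹), ← key, mul_add, Finset.mul_sum, Finset.mul_sum]
  congr 1 <;> refine Finset.sum_congr rfl fun j hj => ?_
  · have e : p ^ (k + 1) = p ^ (k - j + 1) * p ^ j := by
      rw [← pow_add]; congr 1; have := Finset.mem_range.1 hj; omega
    rw [erlangWeight, mul_div_right_comm (a : ℂ), mul_div_right_comm (b : ℂ), mul_pow, mul_pow, e]
    push_cast
    field_simp
  · have e : q ^ (k + 1) = q ^ (k - j + 1) * q ^ j := by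
      rw [← pow_add]; congr 1; have := Finset.mem_range.1 hj; omega
    rw [erlangWeight, mul_div_right_comm (a : ℂ), mul_div_right_comm (b : ℂ), mul_pow, mul_pow, e]
    push_cast
    field_simp

instance isProbabilityMeasure_map_mul (k : ℕ) (a : ℝ) :
    IsProbabilityMeasure ((erlang k).map fun x => a * x) :=
  Measure.isProbabilityMeasure_map (by fun_prop)

lemma charFun_map_mul_erlang (k : ℕ) (a t : ℝ) :
    charFun ((erlang k).map fun x => a * x) t = ((1 - a * t * I) ^ (k + 1))⁻¹ := by
  rw [charFun_map_mul, charFun_erlang, ofReal_mul]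

/-- The characteristic function of `a X + b Z` is the product of those of the summands, with `p = 1
- i a t` and `q = 1 - i b t`, and partial fractions display it as a signed mixture of scaled Erlang
ones. The disjoint union `ℕ ⊕ ℕ` indexes the two scales. -/
lemma integral_linearComb_erlang (k : ℕ) {a b : ℝ} (hab : a ≠ b) {f : ℝ → ℝ} (hf : Measurable f)
    (hfa : ∀ j, Integrable (fun x => f (a * x)) (erlang j))
    (hfb : ∀ j, Integrable (fun x => f (b * x)) (erlang j)) :
    Integrable (fun q : ℝ × ℝ => f (a * q.1 + b * q.2)) ((erlang k).prod (erlang k)) ∧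
    ∫ q : ℝ × ℝ, f (a * q.1 + b * q.2) ∂(erlang k).prod (erlang k) =
      ∑ j ∈ Finset.range (k + 1), erlangWeight a b k j * ∫ x, f (a * x) ∂erlang (k - j) +
      ∑ j ∈ Finset.range (k + 1), erlangWeight b a k j * ∫ x, f (b * x) ∂erlang (k - j) := by
  have hV : Measurable fun q : ℝ × ℝ => a * q.1 + b * q.2 := by fun_prop
  have hVp := Measure.isProbabilityMeasure_map (μ := (erlang k).prod (erlang k)) hV.aemeasurable
  let ν : ℕ ⊕ ℕ → Measure ℝ := Sum.elim (fun j => (erlang (k - j)).map fun x => a * x)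
    fun j => (erlang (k - j)).map fun x => b * x
  have hν : ∀ i, IsProbabilityMeasure (ν i) := by
    rintro (i | i) <;> exact isProbabilityMeasure_map_mul _ _
  have hcf : ∀ t, charFun (((erlang k).prod (erlang k)).map fun q : ℝ × ℝ => a * q.1 + b * q.2) t =
      ∑ i ∈ (Finset.range (k + 1)).disjSum (Finset.range (k + 1)),
        ((Sum.elim (erlangWeight a b k) (erlangWeight b a k) i : ℝ) : ℂ) * charFun (ν i) t := by
    intro t
    rw [Finset.sum_disjSum, charFun_apply_real, integral_map hV.aemeasurable
      (Measurable.aestronglyMeasurable (by fun_prop))]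
    simp only [ν, Sum.elim_inl, Sum.elim_inr, charFun_map_mul_erlang]
    rw [← inv_pow_mul_inv_pow_eq_sum hab, ← charFun_map_mul_erlang, ← charFun_map_mul_erlang,
      charFun_map_mul, charFun_map_mul, charFun_apply_real, charFun_apply_real, ← integral_prod_mul]
    · refine integral_congr_ae (ae_of_all _ fun q => ?_)
      simp only
      rw [← Complex.exp_add]
      push_cast
      ring_nf
    · intro h; have := congrArg re h; simp at this
    · intro h; have := congrArg re h; simp at this
    · ring
  have hint : ∀ i ∈ (Finset.range (k + 1)).disjSum (Finset.range (k + 1)), Integrable f (ν i) := by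
    rintro (i | i) _
    · exact (integrable_map_measure hf.aestronglyMeasurable (by fun_prop)).2 (hfa _)
    · exact (integrable_map_measure hf.aestronglyMeasurable (by fun_prop)).2 (hfb _)
  obtain ⟨h1, h2⟩ := integral_of_charFun_eq_sum _ ν _ hcf hint
  refine ⟨(integrable_map_measure hf.aestronglyMeasurable hV.aemeasurable).1 h1, ?_⟩
  rw [← integral_map hV.aemeasurable hf.aestronglyMeasurable, h2, Finset.sum_disjSum]
  simp only [ν, Sum.elim_inl, Sum.elim_inr]
  congr 1 <;> refine Finset.sum_congr rfl fun j _ => ?_ <;>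
    rw [integral_map (by fun_prop) hf.aestronglyMeasurable]

lemma coef_eq (k j : ℕ) : Params.coef (k + 1) (j + 1) = (-1) ^ j * (j ! * (k + j).choose j) := by
  rw [Params.coef, add_tsub_cancel_right]
  induction j with
  | zero => simp
  | succ j ih =>
    rw [Finset.prod_Icc_succ_top (by omega), ih]
    have h := Nat.add_one_mul_choose_eq (k + j) j
    have h' : ((k : ℝ) + j + 1) * (k + j).choose j = (k + (j + 1)).choose (j + 1) * ((j : ℝ) + 1) := by
      exact_mod_cast h
    rw [Nat.factorial_succ, pow_succ]
    push_cast
    linear_combination (-1) ^ (j + 1) * (j ! : ℝ) * h'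

/-- Dictionary between the coefficients of the closed forms and the mixture weights. The sign
`(-1)^j` of `coef` accounts for `(b - a)^j` against `(a - b)^j`. -/
lemma coef_mul_zpow {a b : ℝ} (ha : 0 < a) (hb : 0 < b) (hab : a ≠ b) (k j : ℕ) :
    Params.coef (k + 1) (j + 1) / j ! * (b⁻¹ - a⁻¹) ^ (1 - ((k + 1 : ℕ) : ℤ) - ((j + 1 : ℕ) : ℤ)) =
      erlangWeight a b k j * (b ^ (k + 1) * a ^ j) := by
  have h1 : b - a ≠ 0 := sub_ne_zero.2 hab.symm
  have h2 : a - b ≠ 0 := sub_ne_zero.2 hab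
  have hj : (j ! : ℝ) ≠ 0 := by positivity
  rw [show (1 - ((k + 1 : ℕ) : ℤ) - ((j + 1 : ℕ) : ℤ)) = -((k + 1 + j : ℕ) : ℤ) by push_cast; ring, zpow_neg,
    zpow_natCast, coef_eq, erlangWeight, show b⁻¹ - a⁻¹ = (a - b) / (a * b) by field_simp, pow_add,
    div_pow, div_pow, div_pow, div_pow, ← neg_sub a b, neg_pow (a - b) j]
  have h3 : ((-1 : ℝ) ^ j) * (-1) ^ j = 1 := by rw [← mul_pow]; simp
  have h4 : ((-1 : ℝ) ^ j) ≠ 0 := pow_ne_zero _ (by norm_num)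
  rw [mul_pow, mul_pow]
  field_simp
  rw [sq, h3, one_mul]

end EHRelay

/-! ### Second-hop expectations, Jensen's inequality and the algebra of the SINR -/

namespace EHRelay
open Set Filter Topology

/-- Integrating out the last variable first leaves a function of `v = a X + b Z` alone, to which the
signed mixture applies; each mixture term is a case of `integral_log_secondHop` with `c` replaced by
`c * a` or `c * b`. -/
lemma integral_log_relay (k : ℕ) {a b c : ℝ} (ha : 0 < a) (hb : 0 < b) (hc : 0 < c) (hab : a ≠ b) :
    Integrable (fun q : (ℝ × ℝ) × ℝ => Real.log (1 + c * (a * q.1.1 + b * q.1.2) * q.2))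
      (((erlang k).prod (erlang k)).prod (erlang k)) ∧
    ∫ q : (ℝ × ℝ) × ℝ, Real.log (1 + c * (a * q.1.1 + b * q.1.2) * q.2)
        ∂((erlang k).prod (erlang k)).prod (erlang k) =
      ∑ j ∈ Finset.range (k + 1), erlangWeight a b k j * ∑ m ∈ Finset.range (k + 1),
        1 / (m ! * (k - j)! : ℝ) * ∫ q : ℝ × ℝ, q.1 ^ m * Real.exp (-q.1) *
          (q.2 ^ (k - j + 1) * Real.exp (-q.2)) / ((c * a)⁻¹ + q.1 * q.2) ∂quadrant +
      ∑ j ∈ Finset.range (k + 1), erlangWeight b a k j * ∑ m ∈ Finset.range (k + 1),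
        1 / (m ! * (k - j)! : ℝ) * ∫ q : ℝ × ℝ, q.1 ^ m * Real.exp (-q.1) *
          (q.2 ^ (k - j + 1) * Real.exp (-q.2)) / ((c * b)⁻¹ + q.1 * q.2) ∂quadrant := by
  have hint : Integrable (fun q : (ℝ × ℝ) × ℝ => Real.log (1 + c * (a * q.1.1 + b * q.1.2) * q.2))
      (((erlang k).prod (erlang k)).prod (erlang k)) := by
    have h := (((((integrable_id_erlang k).const_mul a).comp_fst (erlang k)).add
      (((integrable_id_erlang k).const_mul b).comp_snd (erlang k))).const_mul c).mul_prod
      (integrable_id_erlang k)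
    refine h.mono' (Measurable.aestronglyMeasurable (by fun_prop)) ?_
    have hfst := Measure.quasiMeasurePreserving_fst (μ := (erlang k).prod (erlang k)) (ν := erlang k)
    filter_upwards [hfst.ae (Measure.quasiMeasurePreserving_fst.ae (erlang_pos k)),
      hfst.ae (Measure.quasiMeasurePreserving_snd.ae (erlang_pos k)),
      Measure.quasiMeasurePreserving_snd.ae (erlang_pos k)] with q h1 h2 h3
    have h0 : 0 ≤ c * (a * q.1.1 + b * q.1.2) * q.2 := by positivity
    rw [Real.norm_of_nonneg (Real.log_nonneg (by linarith))]
    have := Real.log_le_sub_one_of_pos (x := 1 + c * (a * q.1.1 + b * q.1.2) * q.2) (by linarith)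
    simp only [Pi.add_apply]
    linarith
  refine ⟨hint, ?_⟩
  have hmeas : Measurable fun v : ℝ => ∫ u, Real.log (1 + c * v * u) ∂erlang k := by
    have : StronglyMeasurable fun q : ℝ × ℝ => Real.log (1 + c * q.1 * q.2) :=
      Measurable.stronglyMeasurable (by fun_prop)
    exact this.integral_prod_right.measurable
  have hcomp : ∀ {a : ℝ}, 0 < a → ∀ j, Integrable (fun x => ∫ u, Real.log (1 + c * (a * x) * u) ∂erlang k)
      (erlang j) ∧ ∫ x, ∫ u, Real.log (1 + c * (a * x) * u) ∂erlang k ∂erlang j =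
        ∑ m ∈ Finset.range (k + 1), 1 / (m ! * j ! : ℝ) * ∫ q : ℝ × ℝ, q.1 ^ m * Real.exp (-q.1) *
          (q.2 ^ (j + 1) * Real.exp (-q.2)) / ((c * a)⁻¹ + q.1 * q.2) ∂quadrant := by
    intro a ha j
    obtain ⟨h1, h2⟩ := integral_log_secondHop k j (c := c * a) (by positivity)
    simp_rw [show ∀ x u, c * (a * x) * u = c * a * x * u from fun x u => by ring]
    refine ⟨h1.integral_prod_left, ?_⟩
    rw [← h2, integral_prod _ h1]
  rw [integral_prod _ hint]
  have := (integral_linearComb_erlang k hab hmeas (fun j => (hcomp ha j).1) fun j => (hcomp hb j).1).2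
  rw [this]
  congr 1 <;> refine Finset.sum_congr rfl fun j _ => ?_
  · rw [(hcomp ha _).2]
  · rw [(hcomp hb _).2]

lemma integral_log_linearComb (k : ℕ) {a b : ℝ} (ha : 0 < a) (hb : 0 < b) (hab : a ≠ b) :
    Integrable (fun q : ℝ × ℝ => Real.log (a * q.1 + b * q.2)) ((erlang k).prod (erlang k)) ∧
    ((∫ q : ℝ × ℝ, Real.log (a * q.1 + b * q.2) ∂(erlang k).prod (erlang k) : ℝ) : ℂ) =
      ∑ j ∈ Finset.range (k + 1), (erlangWeight a b k j : ℂ) *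
        (Complex.digamma (((k - j : ℕ) : ℂ) + 1) + (Real.log a : ℂ)) +
      ∑ j ∈ Finset.range (k + 1), (erlangWeight b a k j : ℂ) *
        (Complex.digamma (((k - j : ℕ) : ℂ) + 1) + (Real.log b : ℂ)) := by
  have hcomp : ∀ {a : ℝ}, 0 < a → ∀ j, Integrable (fun x => Real.log (a * x)) (erlang j) ∧
      ((∫ x, Real.log (a * x) ∂erlang j : ℝ) : ℂ) = Complex.digamma ((j : ℂ) + 1) + (Real.log a : ℂ) := by
    intro a ha j
    have e : (fun x => Real.log (a * x)) =ᵐ[erlang j] fun x => Real.log x + Real.log a := by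
      filter_upwards [erlang_pos j] with x hx
      rw [Real.log_mul ha.ne' hx.ne', add_comm]
    have h := (integrable_log_erlang j).add (integrable_const (Real.log a))
    refine ⟨h.congr e.symm, ?_⟩
    rw [integral_congr_ae e, integral_add (integrable_log_erlang j) (integrable_const _), Complex.ofReal_add,
      integral_log_erlang]
    simp
  obtain ⟨h1, h2⟩ := integral_linearComb_erlang k hab Real.measurable_log (fun j => (hcomp ha j).1)
    fun j => (hcomp hb j).1
  refine ⟨h1, ?_⟩
  rw [h2]
  push_cast
  congr 1 <;> refine Finset.sum_congr rfl fun j _ => ?_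
  · rw [(hcomp ha _).2]
  · rw [(hcomp hb _).2]

/-- The tangent plane of a convex function lies below it. After exponentiation this is a weighted
sum of three instances of `1 + u ≤ e^u`. -/
lemma log_one_add_exp_add_exp_ge (x y x₀ y₀ : ℝ) :
    Real.log (1 + Real.exp x₀ + Real.exp y₀) +
      (Real.exp x₀ * (x - x₀) + Real.exp y₀ * (y - y₀)) / (1 + Real.exp x₀ + Real.exp y₀) ≤
    Real.log (1 + Real.exp x + Real.exp y) := by
  set S := 1 + Real.exp x₀ + Real.exp y₀ with hS
  have hS0 : 0 < S := by positivity
  set L := (Real.exp x₀ * (x - x₀) + Real.exp y₀ * (y - y₀)) / S with hL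
  have hLS : L * S = Real.exp x₀ * (x - x₀) + Real.exp y₀ * (y - y₀) := by rw [hL]; field_simp
  rw [Real.le_log_iff_exp_le (by positivity), Real.exp_add, Real.exp_log hS0]
  -- Since `L` is the weighted mean of the increments `0`, `x - x₀`, `y - y₀`, the linear terms
  -- cancel when the three instances are added.
  have key : ∀ z z₀ : ℝ, Real.exp L * (Real.exp z₀ * (1 + (z - z₀) - L)) ≤ Real.exp z := fun z z₀ => by
    have h := Real.add_one_le_exp (z - z₀ - L)
    have e : Real.exp z = Real.exp L * (Real.exp z₀ * Real.exp (z - z₀ - L)) := by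
      rw [← Real.exp_add, ← Real.exp_add]; ring_nf
    rw [e]
    gcongr
    linarith
  have k0 := key 0 0
  have k1 := key x x₀
  have k2 := key y y₀
  rw [Real.exp_zero] at k0
  have : S * Real.exp L = Real.exp L * (1 * (1 + (0 - 0) - L)) + Real.exp L * (Real.exp x₀ * (1 + (x - x₀) - L)) +
      Real.exp L * (Real.exp y₀ * (1 + (y - y₀) - L)) := by
    have : L * (1 + Real.exp x₀ + Real.exp y₀) = Real.exp x₀ * (x - x₀) + Real.exp y₀ * (y - y₀) := hLS
    rw [hS]
    linear_combination Real.exp L * this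
  linarith

/-- Jensen's inequality for the convex function `(x, y) ↦ log (1 + e^x + e^y)`. -/
lemma log_one_add_exp_integral_le {Ω : Type*} [MeasurableSpace Ω] {P : Measure Ω} [IsProbabilityMeasure P]
    {X Y : Ω → ℝ} (hX : ∀ᵐ ω ∂P, 0 < X ω) (hY : ∀ᵐ ω ∂P, 0 < Y ω)
    (hlX : Integrable (fun ω => Real.log (X ω)) P) (hlY : Integrable (fun ω => Real.log (Y ω)) P)
    (h : Integrable (fun ω => Real.log (1 + X ω + Y ω)) P) :
    Real.log (1 + Real.exp (∫ ω, Real.log (X ω) ∂P) + Real.exp (∫ ω, Real.log (Y ω) ∂P)) ≤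
      ∫ ω, Real.log (1 + X ω + Y ω) ∂P := by
  set x₀ := ∫ ω, Real.log (X ω) ∂P with hx
  set y₀ := ∫ ω, Real.log (Y ω) ∂P with hy
  have i1 : Integrable (fun ω => Real.exp x₀ * (Real.log (X ω) - x₀)) P :=
    (hlX.sub (integrable_const _)).const_mul _
  have i2 : Integrable (fun ω => Real.exp y₀ * (Real.log (Y ω) - y₀)) P :=
    (hlY.sub (integrable_const _)).const_mul _
  have i3 := (i1.add i2).div_const (1 + Real.exp x₀ + Real.exp y₀)
  have hle := integral_mono_ae ((integrable_const (Real.log (1 + Real.exp x₀ + Real.exp y₀))).add i3) h (by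
    filter_upwards [hX, hY] with ω h1 h2
    have := log_one_add_exp_add_exp_ge (Real.log (X ω)) (Real.log (Y ω)) x₀ y₀
    rwa [Real.exp_log h1, Real.exp_log h2] at this)
  rw [integral_add' (integrable_const _) i3, integral_div, integral_add' i1 i2, integral_const_mul,
    integral_const_mul, integral_sub hlX (integrable_const _), integral_sub hlY (integrable_const _)] at hle
  simpa [← hx, ← hy] using hle

/-- The relay matrix has rank one, so every amplitude `h₂ W h` is a multiple of `⟨h₁, h⟩`, and the
relay noise scales with `‖h₁‖`. What is left is an identity of rational functions in the squared
norms. -/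
lemma sinr_eq {N : ℕ} (p : Params) (hPs : 0 < p.Ps) (hPI : 0 < p.PI) (hN₀ : 0 < p.N₀) (hθ₀ : 0 < p.θ)
    (hθ₁ : p.θ < 1) (hη : 0 < p.η) (hd₁ : 0 < p.d₁) (hdI : 0 < p.dI) (hd₂ : 0 < p.d₂)
    (h₁ hI h₂ : EuclideanSpace ℂ (Fin N)) :
    p.sinr h₁ hI h₂ = p.sinr₁ h₁ hI * p.sinr₂ h₁ hI h₂ / (p.sinr₁ h₁ hI + p.sinr₂ h₁ hI h₂ + 1) := by
  have hin : ∀ h : EuclideanSpace ℂ (Fin N), star h₁.ofLp ⬝ᵥ h.ofLp = inner ℂ h₁ h := fun h => by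
    rw [EuclideanSpace.inner_eq_star_dotProduct, dotProduct_comm]
  have hself : h₂.ofLp ⬝ᵥ star h₂.ofLp = ((‖h₂‖ ^ 2 : ℝ) : ℂ) := by
    have := inner_self_eq_norm_sq_to_K (𝕜 := ℂ) h₂
    rw [EuclideanSpace.inner_eq_star_dotProduct] at this
    rw [this]; push_cast; rfl
  set g := p.gainSq h₁ hI with hg
  have hκ : 0 < 1 - p.θ := by linarith
  have hD1 : 0 < p.d₁ ^ p.τ := Real.rpow_pos_of_pos hd₁ _
  have hDI : 0 < p.dI ^ p.τ := Real.rpow_pos_of_pos hdI _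
  have hD2 : 0 < p.d₂ ^ p.τ := Real.rpow_pos_of_pos hd₂ _
  have hg0 : 0 ≤ g := by rw [hg, Params.gainSq, Params.relayPower]; positivity
  set c : ℝ := Real.sqrt g / (‖h₂‖ * ‖h₁‖) with hc
  have hc2 : c ^ 2 = g / (‖h₂‖ ^ 2 * ‖h₁‖ ^ 2) := by rw [hc, div_pow, Real.sq_sqrt hg0, mul_pow]
  have hW : p.relayMatrix h₁ hI h₂ = (c : ℂ) • Matrix.vecMulVec (star h₂.ofLp) (star h₁.ofLp) := rfl
  have e1 : ∀ h : EuclideanSpace ℂ (Fin N), ‖h₂.ofLp ⬝ᵥ (p.relayMatrix h₁ hI h₂).mulVec h.ofLp‖ ^ 2 =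
      c ^ 2 * (‖h₂‖ ^ 2) ^ 2 * ‖(inner ℂ h₁ h : ℂ)‖ ^ 2 := fun h => by
    rw [hW, Matrix.smul_mulVec, Matrix.vecMulVec_mulVec, dotProduct_smul, hin, op_smul_eq_smul,
      dotProduct_smul, hself]
    simp only [smul_eq_mul, norm_mul, Complex.norm_real, Real.norm_eq_abs, mul_pow, sq_abs]
    ring
  have e2 : ‖WithLp.toLp 2 ((p.relayMatrix h₁ hI h₂).vecMul h₂.ofLp)‖ ^ 2 =
      c ^ 2 * (‖h₂‖ ^ 2) ^ 2 * ‖h₁‖ ^ 2 := by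
    rw [hW, Matrix.vecMul_smul, Matrix.vecMul_vecMulVec, hself, WithLp.toLp_smul, WithLp.toLp_smul, norm_smul,
      norm_smul]
    have : ‖WithLp.toLp 2 (star h₁.ofLp)‖ = ‖h₁‖ := by
      rw [EuclideanSpace.norm_eq, EuclideanSpace.norm_eq]; simp
    rw [this]
    simp only [Complex.norm_real, Real.norm_eq_abs, mul_pow, sq_abs]
    ring
  have e3 : ‖(inner ℂ h₁ h₁ : ℂ)‖ ^ 2 = (‖h₁‖ ^ 2) ^ 2 := by
    rw [inner_self_eq_norm_sq_to_K]; simp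
  rw [Params.sinr, Params.sinrOf, e1, e1, e2, e3, hc2]
  -- If `h₁` or `h₂` vanishes, both sides are `0` by the convention for division by zero.
  rcases eq_or_ne (‖h₁‖ ^ 2) 0 with hX | hX
  · simp [Params.sinr₁, hX]
  rcases eq_or_ne (‖h₂‖ ^ 2) 0 with hU | hU
  · simp [Params.sinr₂, hU]
  rw [hg, Params.gainSq, Params.relayPower, Params.sinr₁, Params.sinr₂, Params.ρ₁, Params.ρI]
  have hX0 : 0 < ‖h₁‖ ^ 2 := lt_of_le_of_ne (by positivity) hX.symm
  have hU0 : 0 < ‖h₂‖ ^ 2 := lt_of_le_of_ne (by positivity) hU.symm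
  have hZ0 : 0 ≤ ‖hI‖ ^ 2 := by positivity
  have hJ0 : 0 ≤ ‖(inner ℂ h₁ hI : ℂ)‖ ^ 2 := by positivity
  generalize ‖(inner ℂ h₁ hI : ℂ)‖ ^ 2 = J at *
  generalize ‖h₁‖ ^ 2 = X at *
  generalize ‖h₂‖ ^ 2 = U at *
  generalize ‖hI‖ ^ 2 = Z at *
  generalize p.d₁ ^ p.τ = D1 at *
  generalize p.dI ^ p.τ = DI at *
  generalize p.d₂ ^ p.τ = D2 at *
  -- In units of the noise power `s` is the relay's signal, `q` its interference plus noise and `M`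
  -- the second-hop SNR, so both sides become `s M / (q M + s + q)`.
  set s : ℝ := (1 - p.θ) * (p.Ps / p.N₀) / D1 * X with hs
  set q : ℝ := (1 - p.θ) * (p.PI / p.N₀) / DI * (J / X) + 1 with hq
  set M : ℝ := p.η * p.θ / D2 * (p.Ps / p.N₀ / D1 * X + p.PI / p.N₀ / DI * Z) * U with hM
  have hs0 : 0 < s := by positivity
  have hq0 : 0 < q := by positivity
  have hM0 : 0 < M := by positivity
  have f1 : p.η * p.θ * (p.Ps / D1 * X + p.PI / DI * Z) /
      ((1 - p.θ) * p.Ps / D1 * X + (1 - p.θ) * p.PI / DI * (J / X) + p.N₀) = M * D2 / (U * (s + q)) := by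
    rw [show (1 - p.θ) * p.Ps / D1 * X + (1 - p.θ) * p.PI / DI * (J / X) + p.N₀ = p.N₀ * (s + q) by
      rw [hs, hq]; field_simp; ring]
    rw [hM]
    field_simp
  rw [f1]
  have f2 : (1 - p.θ) * p.Ps / (D1 * D2) * (M * D2 / (U * (s + q)) / (U * X) * U ^ 2 * X ^ 2) =
      p.N₀ * (s * M / (s + q)) := by
    rw [show (1 - p.θ) * p.Ps / (D1 * D2) = s * p.N₀ / (X * D2) by rw [hs]; field_simp]
    field_simp
  have f3 : (1 - p.θ) * p.PI / (DI * D2) * (M * D2 / (U * (s + q)) / (U * X) * U ^ 2 * J) +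
      M * D2 / (U * (s + q)) / (U * X) * U ^ 2 * X / D2 * p.N₀ + p.N₀ =
      p.N₀ * ((q * M + s + q) / (s + q)) := by
    have hJ : (1 - p.θ) * p.PI / (DI * D2) * (M * D2 / (U * (s + q)) / (U * X) * U ^ 2 * J) =
        p.N₀ * ((q - 1) * M / (s + q)) := by
      rw [hq, add_sub_cancel_right, ← hq]
      field_simp
    rw [hJ]
    field_simp
    ring
  rw [f2, f3]
  field_simp
  ring

end EHRelay

/-! ### Transfer to the probability space and identification of the closed forms -/

namespace EHRelay
open Set Filter Topology

section Laws

variable {Ω : Type*} [MeasurableSpace Ω] {P : Measure Ω} [IsProbabilityMeasure P] {k : ℕ}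
  {h₁ hI h₂ : Ω → EuclideanSpace ℂ (Fin (k + 1))}

lemma RayleighFading.hasLaw (h : RayleighFading P h₁ hI h₂) :
    HasLaw (fun ω => (((h₁ ω).ofLp, (hI ω).ofLp), (h₂ ω).ofLp))
      (((stdVec (k + 1)).prod (stdVec (k + 1))).prod (stdVec (k + 1))) P where
  aemeasurable := ((h.aemeasurable 0).prodMk (h.aemeasurable 1)).prodMk (h.aemeasurable 2)
  map_eq := h.map_eq

lemma RayleighFading.hasLaw_firstHop (h : RayleighFading P h₁ hI h₂) :
    HasLaw (fun ω => (‖h₁ ω‖ ^ 2, ‖(inner ℂ (h₁ ω) (hI ω) : ℂ)‖ ^ 2 / ‖h₁ ω‖ ^ 2))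
      ((erlang k).prod (erlang 0)) P := by
  have h1 := (measurePreserving_firstHop k).fun_comp_hasLaw (measurePreserving_fst.fun_comp_hasLaw h.hasLaw)
  have e : ∀ ω, ‖∑ i, starRingEnd ℂ ((h₁ ω).ofLp i) * (hI ω).ofLp i‖ = ‖(inner ℂ (h₁ ω) (hI ω) : ℂ)‖ := fun ω => by
    rw [PiLp.inner_apply]
    simp only [RCLike.inner_apply, mul_comm]
  simpa only [EuclideanSpace.norm_sq_eq, e] using h1

lemma RayleighFading.hasLaw_secondHop (h : RayleighFading P h₁ hI h₂) :
    HasLaw (fun ω => ((‖h₁ ω‖ ^ 2, ‖hI ω‖ ^ 2), ‖h₂ ω‖ ^ 2))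
      (((erlang k).prod (erlang k)).prod (erlang k)) P := by
  have h1 := (measurePreserving_secondHop k).fun_comp_hasLaw h.hasLaw
  simpa only [EuclideanSpace.norm_sq_eq] using h1

end Laws

lemma _root_.ProbabilityTheory.HasLaw.integrable_comp {Ω 𝓧 E : Type*} [MeasurableSpace Ω] [MeasurableSpace 𝓧]
    [NormedAddCommGroup E] {P : Measure Ω} {μ : Measure 𝓧} {X : Ω → 𝓧} (hX : HasLaw X μ P)
    {f : 𝓧 → E} (hf : Integrable f μ) : Integrable (fun ω => f (X ω)) P := by
  rw [← hX.map_eq] at hf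
  exact hf.comp_aemeasurable hX.aemeasurable

lemma ergodicCapacity_eq {Ω : Type*} [MeasurableSpace Ω] (P : Measure Ω) (γ : Ω → ℝ) :
    ergodicCapacity P γ = 1 / (2 * Real.log 2) * ∫ ω, Real.log (1 + γ ω) ∂P := by
  simp only [ergodicCapacity, Real.logb]
  rw [integral_div]
  field_simp

section ClosedForms

variable (p : Params) (k : ℕ)

lemma capTerm₁_eq (hρ₁ : 0 < p.ρ₁) (hρI : 0 < p.ρI) (hκ : 0 < 1 - p.θ) (hD₁ : 0 < p.d₁ ^ p.τ)
    (hDI : 0 < p.dI ^ p.τ) :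
    p.capTerm₁ (k + 1) = ((1 / (2 * Real.log 2) *
      ∫ q : ℝ × ℝ, Real.log (1 + (1 - p.θ) * p.ρ₁ / p.d₁ ^ p.τ * q.1 /
        ((1 - p.θ) * p.ρI / p.dI ^ p.τ * q.2 + 1)) ∂(erlang k).prod (erlang 0) : ℝ) : ℂ) := by
  rw [(integral_log_firstHop k (by positivity) (by positivity)).2, Params.capTerm₁, Finset.mul_sum,
    Finset.mul_sum, Complex.ofReal_sum]
  refine Finset.sum_congr rfl fun m _ => ?_
  rw [Finset.mul_sum, Finset.mul_sum, Complex.ofReal_sum]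
  refine Finset.sum_congr rfl fun n _ => ?_
  rw [bivariateMeijerG_eq m n (by positivity) (by positivity), ← Complex.ofReal_mul, ← Complex.ofReal_mul]
  congr 1
  have : Real.log 2 ≠ 0 := (Real.log_pos one_lt_two).ne'
  have : (n ! : ℝ) ≠ 0 := by positivity
  rw [div_pow]
  field_simp

/-- The double sum collapses to `∑ 1/m`, which with `digamma 1` makes up the Erlang mean of `log x`;
the G-function term is the mean of `log (1 + B y)` under exponential interference. -/
lemma logTerm₁_eq (hρ₁ : 0 < p.ρ₁) (hρI : 0 < p.ρI) (hκ : 0 < 1 - p.θ) (hD₁ : 0 < p.d₁ ^ p.τ)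
    (hDI : 0 < p.dI ^ p.τ) :
    p.logTerm₁ (k + 1) = ((Real.log ((1 - p.θ) * p.ρ₁ / p.d₁ ^ p.τ) + ∫ x, Real.log x ∂erlang k -
      ∫ y, Real.log (1 + (1 - p.θ) * p.ρI / p.dI ^ p.τ * y) ∂erlang 0 : ℝ) : ℂ) := by
  set B := (1 - p.θ) * p.ρI / p.dI ^ p.τ with hB
  have hB0 : 0 < B := by positivity
  have hBinv : p.dI ^ p.τ / ((1 - p.θ) * p.ρI) = 1 / B := by rw [hB]; field_simp
  have hsum : ∀ m ∈ Finset.Icc 1 (k + 1 - 1), (∑ n ∈ Finset.range (m + 1),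
      ((((1 - p.θ) * p.ρI) ^ ((n : ℤ) - (m : ℤ)) / ((m - n)! * (p.dI ^ p.τ) ^ ((n : ℤ) - (m : ℤ))) *
        Real.Gamma m * tricomi m ((m : ℝ) - n) (1 / B) : ℝ) : ℂ)) = ((1 / (m : ℝ) : ℝ) : ℂ) := by
    intro m hm
    rw [← sum_tricomi hB0 (Finset.mem_Icc.1 hm).1, Complex.ofReal_sum]
    refine Finset.sum_congr rfl fun n _ => ?_
    rw [hB, div_zpow]
    congr 3
    field_simp
  rw [Params.logTerm₁, hBinv, Finset.sum_congr rfl hsum, add_tsub_cancel_right,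
    meijerG_expIntegral (by positivity), ← Complex.ofReal_mul, exp_mul_integral_expInt hB0]
  push_cast
  rw [integral_log_erlang, digamma_natCast_add_one, Real.log_div (by positivity) (by positivity)]
  push_cast
  ring

lemma digamma_arg {j : ℕ} (hj : j ∈ Finset.range (k + 1)) :
    ((k + 1 : ℕ) : ℂ) - ((1 + j : ℕ) : ℂ) + 1 = ((k - j : ℕ) : ℂ) + 1 := by
  rw [Nat.cast_sub (Finset.mem_range_succ_iff.1 hj)]
  push_cast
  ring

lemma sum_Icc_one_eq {M : Type*} [AddCommMonoid M] (f : ℕ → M) :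
    ∑ s ∈ Finset.Icc 1 (k + 1), f s = ∑ j ∈ Finset.range (k + 1), f (j + 1) := by
  rw [Finset.sum_bij (fun s _ => s - 1) (t := Finset.range (k + 1)) (g := fun j => f (j + 1))]
  · intro s hs; have := Finset.mem_Icc.1 hs; simp; omega
  · intro s hs t ht h; have := Finset.mem_Icc.1 hs; have := Finset.mem_Icc.1 ht; omega
  · intro j hj; exact ⟨j + 1, by have := Finset.mem_range.1 hj; simp; omega, by simp⟩
  · intro s hs; have := Finset.mem_Icc.1 hs; congr 1; omega

lemma logTerm₂_eq (hρ₁ : 0 < p.ρ₁) (hρI : 0 < p.ρI) (hηθ : 0 < p.η * p.θ) (hD₁ : 0 < p.d₁ ^ p.τ)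
    (hDI : 0 < p.dI ^ p.τ) (hD₂ : 0 < p.d₂ ^ p.τ) (hne : p.ρ₁ / p.d₁ ^ p.τ ≠ p.ρI / p.dI ^ p.τ) :
    p.logTerm₂ (k + 1) = ((Real.log (p.η * p.θ / p.d₂ ^ p.τ) + ∫ x, Real.log x ∂erlang k +
      ∫ q : ℝ × ℝ, Real.log (p.ρ₁ / p.d₁ ^ p.τ * q.1 + p.ρI / p.dI ^ p.τ * q.2) ∂(erlang k).prod (erlang k) : ℝ)
        : ℂ) := by
  set a := p.ρ₁ / p.d₁ ^ p.τ with ha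
  set b := p.ρI / p.dI ^ p.τ with hb
  have ha0 : 0 < a := by positivity
  have hb0 : 0 < b := by positivity
  -- Proved for generic `a`, `b` because the second sum is the first with the two scales exchanged.
  have term : ∀ {a b : ℝ}, 0 < a → 0 < b → a ≠ b → ∀ j,
      (b ^ (k + 1))⁻¹ * (Params.coef (k + 1) (j + 1) / (j + 1 - 1)! *
        (b⁻¹ - a⁻¹) ^ (1 - ((k + 1 : ℕ) : ℤ) - ((j + 1 : ℕ) : ℤ)) * a ^ (1 - ((j + 1 : ℕ) : ℤ))) =
      erlangWeight a b k j := fun {a b} ha hb hab j => by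
    rw [add_tsub_cancel_right, coef_mul_zpow ha hb hab, show (1 - ((j + 1 : ℕ) : ℤ)) = -(j : ℤ) by push_cast; ring,
      zpow_neg, zpow_natCast]
    field_simp
  rw [Params.logTerm₂, Complex.ofReal_add, Complex.ofReal_add, integral_log_erlang,
    (integral_log_linearComb k ha0 hb0 hne).2, sum_Icc_one_eq, sum_Icc_one_eq, Finset.mul_sum, Finset.mul_sum,
    ← Real.log_div (by positivity) (by positivity), ← Real.log_div (by positivity) (by positivity),
    ← Real.log_div (by positivity) (by positivity), ← ha, ← hb, ← add_assoc, Nat.cast_succ]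
  have ea : p.d₁ ^ p.τ / p.ρ₁ = a⁻¹ := by rw [ha, inv_div]
  have eb : p.dI ^ p.τ / p.ρI = b⁻¹ := by rw [hb, inv_div]
  congr 1
  · congr 1
    refine Finset.sum_congr rfl fun j hj => ?_
    rw [← mul_assoc, ← Complex.ofReal_mul, ← div_pow, ea, eb, inv_pow, term ha0 hb0 hne, ← digamma_arg k hj]
    push_cast
    ring_nf
  · refine Finset.sum_congr rfl fun j hj => ?_
    rw [← mul_assoc, ← Complex.ofReal_mul, ← div_pow, ea, eb, inv_pow, term hb0 ha0 hne.symm, ← digamma_arg k hj]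
    push_cast
    ring_nf

lemma capTerm₂_eq (hρ₁ : 0 < p.ρ₁) (hρI : 0 < p.ρI) (hηθ : 0 < p.η * p.θ) (hD₁ : 0 < p.d₁ ^ p.τ)
    (hDI : 0 < p.dI ^ p.τ) (hD₂ : 0 < p.d₂ ^ p.τ) (hne : p.ρ₁ / p.d₁ ^ p.τ ≠ p.ρI / p.dI ^ p.τ) :
    p.capTerm₂ (k + 1) = ((1 / (2 * Real.log 2) *
      ∫ q : (ℝ × ℝ) × ℝ, Real.log (1 + p.η * p.θ / p.d₂ ^ p.τ *
        (p.ρ₁ / p.d₁ ^ p.τ * q.1.1 + p.ρI / p.dI ^ p.τ * q.1.2) * q.2)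
          ∂((erlang k).prod (erlang k)).prod (erlang k) : ℝ) : ℂ) := by
  set a := p.ρ₁ / p.d₁ ^ p.τ with ha
  set b := p.ρI / p.dI ^ p.τ with hb
  set c := p.η * p.θ / p.d₂ ^ p.τ with hc
  have ha0 : 0 < a := by positivity
  have hb0 : 0 < b := by positivity
  have hc0 : 0 < c := by positivity
  have hlog : Real.log 2 ≠ 0 := (Real.log_pos one_lt_two).ne'
  have ea : p.d₁ ^ p.τ / p.ρ₁ = a⁻¹ := by rw [ha, inv_div]
  have eb : p.dI ^ p.τ / p.ρI = b⁻¹ := by rw [hb, inv_div]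
  have ec : p.d₂ ^ p.τ / (p.η * p.θ) = c⁻¹ := by rw [hc, inv_div]
  have e1 : p.d₁ ^ p.τ * p.d₂ ^ p.τ / (p.η * p.θ * p.ρ₁) = (c * a)⁻¹ := by
    rw [mul_inv, ← ea, ← ec]; field_simp
  have e2 : p.d₂ ^ p.τ * p.dI ^ p.τ / (p.η * p.θ * p.ρI) = (c * b)⁻¹ := by
    rw [mul_inv, ← eb, ← ec]; field_simp
  have e3 : (p.d₁ ^ p.τ) ^ (k + 1) * (p.dI ^ p.τ) ^ (k + 1) / (p.ρ₁ ^ (k + 1) * p.ρI ^ (k + 1) * (2 * Real.log 2)) =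
      (a ^ (k + 1))⁻¹ * (b ^ (k + 1))⁻¹ * (1 / (2 * Real.log 2)) := by
    rw [ha, hb, div_pow, div_pow]; field_simp
  have term : ∀ {a b : ℝ}, 0 < a → 0 < b → a ≠ b → ∀ j ∈ Finset.range (k + 1),
      (((a ^ (k + 1))⁻¹ * (b ^ (k + 1))⁻¹ * (1 / (2 * Real.log 2)) : ℝ) : ℂ) *
        (((Params.coef (k + 1) (j + 1) / ((k + 1 - (j + 1))! * (j + 1 - 1)!) *
          (b⁻¹ - a⁻¹) ^ (1 - ((k + 1 : ℕ) : ℤ) - ((j + 1 : ℕ) : ℤ)) : ℝ) : ℂ) *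
          ∑ m ∈ Finset.range (k + 1), ((1 / (m ! : ℝ) * c⁻¹ ^ (k + 1 + 1 - (j + 1)) : ℝ) : ℂ) *
            Params.hopG (k + 1) (j + 1) m (c * a)⁻¹) =
      ((1 / (2 * Real.log 2) * (erlangWeight a b k j * ∑ m ∈ Finset.range (k + 1),
        1 / (m ! * (k - j)! : ℝ) * ∫ q : ℝ × ℝ, q.1 ^ m * Real.exp (-q.1) *
          (q.2 ^ (k - j + 1) * Real.exp (-q.2)) / ((c * a)⁻¹ + q.1 * q.2) ∂quadrant) : ℝ) : ℂ) := by
    intro a b ha hb hab j hj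
    have hjk := Finset.mem_range_succ_iff.1 hj
    have hcoef : Params.coef (k + 1) (j + 1) / ((k + 1 - (j + 1))! * (j + 1 - 1)!) *
        (b⁻¹ - a⁻¹) ^ (1 - ((k + 1 : ℕ) : ℤ) - ((j + 1 : ℕ) : ℤ)) =
        ((k - j)! : ℝ)⁻¹ * (erlangWeight a b k j * (b ^ (k + 1) * a ^ j)) := by
      rw [← coef_mul_zpow ha hb hab, Nat.add_sub_add_right, add_tsub_cancel_right]
      have : (j ! : ℝ) ≠ 0 := by positivity
      field_simp
    rw [hcoef, Finset.mul_sum, Finset.mul_sum, Finset.mul_sum, Finset.mul_sum, Complex.ofReal_sum]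
    refine Finset.sum_congr rfl fun m _ => ?_
    rw [hopG_eq (by omega) m (by positivity), show k + 1 + 1 - (j + 1) = k - j + 1 by omega,
      ← Complex.ofReal_mul, ← Complex.ofReal_mul, ← Complex.ofReal_mul]
    congr 1
    generalize (∫ q : ℝ × ℝ, q.1 ^ m * Real.exp (-q.1) * (q.2 ^ (k - j + 1) * Real.exp (-q.2)) /
      ((c * a)⁻¹ + q.1 * q.2) ∂quadrant) = J
    -- The factor `(c a)^(k - j + 1)` produced by `hopG_eq`, the prefactor `a^-(k + 1)` and the
    -- `a^j` from the weight cancel, as do the powers of `b` and `c`.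
    have hpow : a ^ (k + 1) = a ^ (k - j + 1) * a ^ j := by rw [← pow_add]; congr 1; omega
    rw [hpow, inv_pow, inv_pow, inv_inv, mul_pow]
    field_simp
  rw [(integral_log_relay k ha0 hb0 hc0 hne).2, mul_add, Complex.ofReal_add, Params.capTerm₂, ea, eb, ec, e1, e2, e3,
    sum_Icc_one_eq, sum_Icc_one_eq, Finset.mul_sum, Finset.mul_sum, Finset.mul_sum, Finset.mul_sum,
    Complex.ofReal_sum, Complex.ofReal_sum]
  congr 1
  · exact Finset.sum_congr rfl fun j hj => term ha0 hb0 hne j hj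
  · refine Finset.sum_congr rfl fun j hj => ?_
    rw [← term hb0 ha0 hne.symm j hj, mul_comm (a ^ (k + 1))⁻¹]

end ClosedForms

end EHRelay

/-! ### Logarithmic means of the hop SNRs and the capacity inequality -/

namespace EHRelay
open Set Filter Topology

lemma integral_log_firstHop_snr (k : ℕ) {A B : ℝ} (hA : 0 < A) (hB : 0 ≤ B) :
    Integrable (fun q : ℝ × ℝ => Real.log (A * q.1 / (B * q.2 + 1))) ((erlang k).prod (erlang 0)) ∧
    ∫ q : ℝ × ℝ, Real.log (A * q.1 / (B * q.2 + 1)) ∂(erlang k).prod (erlang 0) =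
      Real.log A + ∫ x, Real.log x ∂erlang k - ∫ y, Real.log (1 + B * y) ∂erlang 0 := by
  have h1 := (integrable_log_erlang k).comp_fst (erlang 0)
  have h2 := (integrable_log_one_add_mul_erlang 0 hB).comp_snd (erlang k)
  have h12 := (integrable_const (Real.log A)).add h1
  have e : (fun q : ℝ × ℝ => Real.log (A * q.1 / (B * q.2 + 1))) =ᵐ[(erlang k).prod (erlang 0)]
      fun q => Real.log A + Real.log q.1 - Real.log (1 + B * q.2) := by
    filter_upwards [Measure.quasiMeasurePreserving_fst.ae (erlang_pos k),
      Measure.quasiMeasurePreserving_snd.ae (erlang_pos 0)] with q h1 h2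
    rw [Real.log_div (by positivity) (by positivity), Real.log_mul hA.ne' h1.ne', add_comm (B * q.2)]
  refine ⟨(h12.sub h2).congr e.symm, ?_⟩
  rw [integral_congr_ae e, integral_sub (by exact h12) h2, integral_add (integrable_const _) h1, integral_const,
    integral_fun_fst, integral_fun_snd (fun y => Real.log (1 + B * y))]
  simp

lemma integral_log_relay_snr (k : ℕ) {a b c : ℝ} (ha : 0 < a) (hb : 0 < b) (hc : 0 < c) (hab : a ≠ b) :
    Integrable (fun q : (ℝ × ℝ) × ℝ => Real.log (c * (a * q.1.1 + b * q.1.2) * q.2))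
      (((erlang k).prod (erlang k)).prod (erlang k)) ∧
    ∫ q : (ℝ × ℝ) × ℝ, Real.log (c * (a * q.1.1 + b * q.1.2) * q.2)
        ∂((erlang k).prod (erlang k)).prod (erlang k) =
      Real.log c + ∫ x, Real.log x ∂erlang k +
        ∫ q : ℝ × ℝ, Real.log (a * q.1 + b * q.2) ∂(erlang k).prod (erlang k) := by
  have h1 := (integral_log_linearComb k ha hb hab).1.comp_fst (erlang k)
  have h2 := (integrable_log_erlang k).comp_snd ((erlang k).prod (erlang k))
  have h12 := (integrable_const (Real.log c)).add h2
  have e : (fun q : (ℝ × ℝ) × ℝ => Real.log (c * (a * q.1.1 + b * q.1.2) * q.2))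
      =ᵐ[((erlang k).prod (erlang k)).prod (erlang k)]
      fun q => Real.log c + Real.log q.2 + Real.log (a * q.1.1 + b * q.1.2) := by
    filter_upwards [Measure.quasiMeasurePreserving_fst.ae (Measure.quasiMeasurePreserving_fst.ae (erlang_pos k)),
      Measure.quasiMeasurePreserving_fst.ae (Measure.quasiMeasurePreserving_snd.ae (erlang_pos k)),
      Measure.quasiMeasurePreserving_snd.ae (erlang_pos k)] with q h1 h2 h3
    rw [Real.log_mul (by positivity) h3.ne', Real.log_mul hc.ne' (by positivity)]
    ring
  refine ⟨(h12.add h1).congr e.symm, ?_⟩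
  rw [integral_congr_ae e, integral_add (by exact h12) h1, integral_add (integrable_const _) h2, integral_const,
    integral_fun_snd, integral_fun_fst (fun q : ℝ × ℝ => Real.log (a * q.1 + b * q.2))]
  simp

/-- The end-to-end ratio `xy / (x + y + 1)` satisfies
`(1 + x) (1 + y) = (1 + x + y) (1 + xy / (x + y + 1))`. -/
lemma log_one_add_harmonic {x y : ℝ} (hx : 0 < x) (hy : 0 < y) :
    Real.log (1 + x + y) =
      Real.log (1 + x) + Real.log (1 + y) - Real.log (1 + x * y / (x + y + 1)) := by
  rw [eq_sub_iff_add_eq, ← Real.log_mul (by positivity) (by positivity),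
    ← Real.log_mul (by positivity) (by positivity)]
  congr 1
  field_simp
  ring

/-- The end-to-end ratio never exceeds the first-hop value, so its logarithm is dominated. -/
lemma integrable_log_one_add_harmonic {Ω : Type*} [MeasurableSpace Ω] {P : Measure Ω} {X Y : Ω → ℝ}
    (hX : ∀ᵐ ω ∂P, 0 < X ω) (hY : ∀ᵐ ω ∂P, 0 < Y ω) (mX : AEMeasurable X P) (mY : AEMeasurable Y P)
    (h : Integrable (fun ω => Real.log (1 + X ω)) P) :
    Integrable (fun ω => Real.log (1 + X ω * Y ω / (X ω + Y ω + 1))) P := by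
  refine h.mono' (AEMeasurable.aestronglyMeasurable (by fun_prop)) ?_
  filter_upwards [hX, hY] with ω hx hy
  have h0 : 0 < X ω * Y ω / (X ω + Y ω + 1) := by positivity
  rw [Real.norm_of_nonneg (Real.log_nonneg (by linarith))]
  refine Real.log_le_log (by linarith) ?_
  have : X ω * Y ω / (X ω + Y ω + 1) ≤ X ω := by
    rw [div_le_iff₀ (by positivity)]
    nlinarith
  linarith

/-- Jensen's inequality for the capacity of a dual-hop link. -/
lemma ergodicCapacity_harmonic_le {Ω : Type*} [MeasurableSpace Ω] {P : Measure Ω} [IsProbabilityMeasure P]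
    {X Y : Ω → ℝ} (hX : ∀ᵐ ω ∂P, 0 < X ω) (hY : ∀ᵐ ω ∂P, 0 < Y ω) (mX : AEMeasurable X P)
    (mY : AEMeasurable Y P) (hlX : Integrable (fun ω => Real.log (X ω)) P)
    (hlY : Integrable (fun ω => Real.log (Y ω)) P) (h1X : Integrable (fun ω => Real.log (1 + X ω)) P)
    (h1Y : Integrable (fun ω => Real.log (1 + Y ω)) P) :
    ergodicCapacity P (fun ω => X ω * Y ω / (X ω + Y ω + 1)) ≤
      ergodicCapacity P X + ergodicCapacity P Y - 1 / 2 * Real.logb 2 (1 +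
        Real.exp (∫ ω, Real.log (X ω) ∂P) + Real.exp (∫ ω, Real.log (Y ω) ∂P)) := by
  have hZ := integrable_log_one_add_harmonic hX hY mX mY h1X
  have e : (fun ω => Real.log (1 + X ω + Y ω)) =ᵐ[P] fun ω => Real.log (1 + X ω) + Real.log (1 + Y ω) -
      Real.log (1 + X ω * Y ω / (X ω + Y ω + 1)) := by
    filter_upwards [hX, hY] with ω hx hy using log_one_add_harmonic hx hy
  have hJ := log_one_add_exp_integral_le hX hY hlX hlY (((h1X.add h1Y).sub hZ).congr e.symm)
  rw [integral_congr_ae e, integral_sub (by exact h1X.add h1Y) hZ, integral_add h1X h1Y] at hJ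
  rw [ergodicCapacity_eq, ergodicCapacity_eq, ergodicCapacity_eq, Real.logb]
  have hlog : 0 < Real.log 2 := Real.log_pos one_lt_two
  have := mul_le_mul_of_nonneg_left hJ (by positivity : 0 ≤ 1 / (2 * Real.log 2))
  calc _ = 1 / (2 * Real.log 2) * (∫ ω, Real.log (1 + X ω) ∂P) + 1 / (2 * Real.log 2) * (∫ ω, Real.log (1 + Y ω) ∂P) -
        1 / (2 * Real.log 2) * (∫ ω, Real.log (1 + X ω) ∂P + ∫ ω, Real.log (1 + Y ω) ∂P -
          ∫ ω, Real.log (1 + X ω * Y ω / (X ω + Y ω + 1)) ∂P) := by ring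
    _ ≤ 1 / (2 * Real.log 2) * (∫ ω, Real.log (1 + X ω) ∂P) + 1 / (2 * Real.log 2) * (∫ ω, Real.log (1 + Y ω) ∂P) -
        1 / (2 * Real.log 2) * _ := sub_le_sub_left this _
    _ = _ := by ring

end EHRelay

/-! ### Assembly -/

theorem theorem6 {Ω : Type*} [MeasurableSpace Ω] (P : MeasureTheory.Measure Ω)
    [MeasureTheory.IsProbabilityMeasure P] (N : ℕ) (hN : 1 ≤ N) (p : EHRelay.Params)
    (hPs : 0 < p.Ps) (hPI : 0 < p.PI) (hN₀ : 0 < p.N₀) (hθ₀ : 0 < p.θ) (hθ₁ : p.θ < 1)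
    (hη : 0 < p.η) (hd₁ : 0 < p.d₁) (hdI : 0 < p.dI) (hd₂ : 0 < p.d₂)
    (hne : p.ρ₁ / p.d₁ ^ p.τ ≠ p.ρI / p.dI ^ p.τ)
    (h₁ hI h₂ : Ω → EuclideanSpace ℂ (Fin N)) (hfading : EHRelay.RayleighFading P h₁ hI h₂) :
    -- all expectations involved exist
    MeasureTheory.Integrable (fun ω => Real.logb 2 (1 + p.sinr (h₁ ω) (hI ω) (h₂ ω))) P ∧
    MeasureTheory.Integrable (fun ω => Real.logb 2 (1 + p.sinr₁ (h₁ ω) (hI ω))) P ∧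
    MeasureTheory.Integrable (fun ω => Real.logb 2 (1 + p.sinr₂ (h₁ ω) (hI ω) (h₂ ω))) P ∧
    MeasureTheory.Integrable (fun ω => Real.log (p.sinr₁ (h₁ ω) (hI ω))) P ∧
    MeasureTheory.Integrable (fun ω => Real.log (p.sinr₂ (h₁ ω) (hI ω) (h₂ ω))) P ∧
    -- the four terms of the bound in closed form
    (EHRelay.ergodicCapacity P (fun ω => p.sinr₁ (h₁ ω) (hI ω)) : ℂ) = p.capTerm₁ N ∧
    (EHRelay.ergodicCapacity P (fun ω => p.sinr₂ (h₁ ω) (hI ω) (h₂ ω)) : ℂ) = p.capTerm₂ N ∧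
    ((∫ ω, Real.log (p.sinr₁ (h₁ ω) (hI ω)) ∂P : ℝ) : ℂ) = p.logTerm₁ N ∧
    ((∫ ω, Real.log (p.sinr₂ (h₁ ω) (hI ω) (h₂ ω)) ∂P : ℝ) : ℂ) = p.logTerm₂ N ∧
    -- the upper bound on the ergodic capacity
    EHRelay.ergodicCapacity P (fun ω => p.sinr (h₁ ω) (hI ω) (h₂ ω)) ≤ p.capacityBound N := by
  -- `N = k + 1`, matching `erlang k`, which has shape `k + 1`.
  obtain ⟨k, rfl⟩ := Nat.exists_eq_add_of_le' hN
  have hρ₁ : 0 < p.ρ₁ := div_pos hPs hN₀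
  have hρI : 0 < p.ρI := div_pos hPI hN₀
  have hκ : 0 < 1 - p.θ := sub_pos.2 hθ₁
  have hηθ : 0 < p.η * p.θ := mul_pos hη hθ₀
  have hD₁ : 0 < p.d₁ ^ p.τ := Real.rpow_pos_of_pos hd₁ _
  have hDI : 0 < p.dI ^ p.τ := Real.rpow_pos_of_pos hdI _
  have hD₂ : 0 < p.d₂ ^ p.τ := Real.rpow_pos_of_pos hd₂ _
  have hA : 0 < (1 - p.θ) * p.ρ₁ / p.d₁ ^ p.τ := by positivity
  have hB : 0 < (1 - p.θ) * p.ρI / p.dI ^ p.τ := by positivity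
  have ha : 0 < p.ρ₁ / p.d₁ ^ p.τ := by positivity
  have hb : 0 < p.ρI / p.dI ^ p.τ := by positivity
  have hc : 0 < p.η * p.θ / p.d₂ ^ p.τ := by positivity
  have law₁ := hfading.hasLaw_firstHop
  have law₂ := hfading.hasLaw_secondHop
  have cap₁ := EHRelay.integral_log_firstHop k hA hB.le
  have cap₂ := EHRelay.integral_log_relay k ha hb hc hne
  have snr₁ := EHRelay.integral_log_firstHop_snr k hA hB.le
  have snr₂ := EHRelay.integral_log_relay_snr k ha hb hc hne
  have iC₁ : MeasureTheory.Integrable (fun ω => Real.log (1 + p.sinr₁ (h₁ ω) (hI ω))) P :=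
    law₁.integrable_comp cap₁.1
  have iC₂ : MeasureTheory.Integrable (fun ω => Real.log (1 + p.sinr₂ (h₁ ω) (hI ω) (h₂ ω))) P :=
    law₂.integrable_comp cap₂.1
  have iL₁ : MeasureTheory.Integrable (fun ω => Real.log (p.sinr₁ (h₁ ω) (hI ω))) P :=
    law₁.integrable_comp snr₁.1
  have iL₂ : MeasureTheory.Integrable (fun ω => Real.log (p.sinr₂ (h₁ ω) (hI ω) (h₂ ω))) P :=
    law₂.integrable_comp snr₂.1
  have eC₁ : (EHRelay.ergodicCapacity P (fun ω => p.sinr₁ (h₁ ω) (hI ω)) : ℂ) = p.capTerm₁ (k + 1) := by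
    rw [EHRelay.capTerm₁_eq p k hρ₁ hρI hκ hD₁ hDI, EHRelay.ergodicCapacity_eq,
      ← law₁.integral_comp cap₁.1.aestronglyMeasurable]
    rfl
  have eC₂ : (EHRelay.ergodicCapacity P (fun ω => p.sinr₂ (h₁ ω) (hI ω) (h₂ ω)) : ℂ) = p.capTerm₂ (k + 1) := by
    rw [EHRelay.capTerm₂_eq p k hρ₁ hρI hηθ hD₁ hDI hD₂ hne, EHRelay.ergodicCapacity_eq,
      ← law₂.integral_comp cap₂.1.aestronglyMeasurable]
    rfl
  have eL₁ : ((∫ ω, Real.log (p.sinr₁ (h₁ ω) (hI ω)) ∂P : ℝ) : ℂ) = p.logTerm₁ (k + 1) := by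
    rw [EHRelay.logTerm₁_eq p k hρ₁ hρI hκ hD₁ hDI, ← snr₁.2,
      ← law₁.integral_comp snr₁.1.aestronglyMeasurable]
    rfl
  have eL₂ : ((∫ ω, Real.log (p.sinr₂ (h₁ ω) (hI ω) (h₂ ω)) ∂P : ℝ) : ℂ) = p.logTerm₂ (k + 1) := by
    rw [EHRelay.logTerm₂_eq p k hρ₁ hρI hηθ hD₁ hDI hD₂ hne, ← snr₂.2,
      ← law₂.integral_comp snr₂.1.aestronglyMeasurable]
    rfl
  -- The logarithmic identities need strictly positive SNRs; the channels are nonzero almost surely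
  -- because Erlang laws charge only the positive axis.
  have pos_norm : ∀ᵐ ω ∂P, (0 < ‖h₁ ω‖ ^ 2 ∧ 0 < ‖hI ω‖ ^ 2) ∧ 0 < ‖h₂ ω‖ ^ 2 := by
    have h : ∀ᵐ q ∂((EHRelay.erlang k).prod (EHRelay.erlang k)).prod (EHRelay.erlang k),
        (0 < q.1.1 ∧ 0 < q.1.2) ∧ 0 < q.2 :=
      ((Measure.quasiMeasurePreserving_fst.ae (Measure.quasiMeasurePreserving_fst.ae (EHRelay.erlang_pos k))).and
        (Measure.quasiMeasurePreserving_fst.ae (Measure.quasiMeasurePreserving_snd.ae (EHRelay.erlang_pos k)))).and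
        (Measure.quasiMeasurePreserving_snd.ae (EHRelay.erlang_pos k))
    rw [← law₂.map_eq] at h
    exact ae_of_ae_map law₂.aemeasurable h
  have pos₁ : ∀ᵐ ω ∂P, 0 < p.sinr₁ (h₁ ω) (hI ω) := by
    filter_upwards [pos_norm] with ω h1
    exact div_pos (mul_pos hA h1.1.1) (by positivity)
  have pos₂ : ∀ᵐ ω ∂P, 0 < p.sinr₂ (h₁ ω) (hI ω) (h₂ ω) := by
    filter_upwards [pos_norm] with ω ⟨⟨h1, h2⟩, h3⟩
    exact mul_pos (mul_pos hc (add_pos (mul_pos ha h1) (mul_pos hb h2))) h3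
  have meas₁ : AEMeasurable (fun ω => p.sinr₁ (h₁ ω) (hI ω)) P :=
    (((law₁.aemeasurable.fst.const_mul _).div ((law₁.aemeasurable.snd.const_mul _).add_const 1)))
  have meas₂ : AEMeasurable (fun ω => p.sinr₂ (h₁ ω) (hI ω) (h₂ ω)) P :=
    ((((law₂.aemeasurable.fst.fst.const_mul _).add (law₂.aemeasurable.fst.snd.const_mul _)).const_mul _).mul
      law₂.aemeasurable.snd)
  have esinr : ∀ ω, p.sinr (h₁ ω) (hI ω) (h₂ ω) = p.sinr₁ (h₁ ω) (hI ω) * p.sinr₂ (h₁ ω) (hI ω) (h₂ ω) /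
      (p.sinr₁ (h₁ ω) (hI ω) + p.sinr₂ (h₁ ω) (hI ω) (h₂ ω) + 1) := fun ω =>
    EHRelay.sinr_eq p hPs hPI hN₀ hθ₀ hθ₁ hη hd₁ hdI hd₂ _ _ _
  refine ⟨?_, iC₁.div_const _, iC₂.div_const _, iL₁, iL₂, eC₁, eC₂, eL₁, eL₂, ?_⟩
  · simp only [esinr]
    exact (EHRelay.integrable_log_one_add_harmonic pos₁ pos₂ meas₁ meas₂ iC₁).div_const _
  · simp only [esinr]
    rw [EHRelay.Params.capacityBound, ← eC₁, ← eC₂, ← eL₁, ← eL₂]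
    exact EHRelay.ergodicCapacity_harmonic_le pos₁ pos₂ meas₁ meas₂ iL₁ iL₂ iC₁ iC₂
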